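/- Let $(M,g)$ be a smooth oriented 4-dimensional Lorentzian manifold of signature $(+,-,-,-)$ (Hausdorff, second countable), with volume form $\varepsilon$, and let $\star$ be the Hodge star on 2-forms, $(\star F)_{ab}=\tfrac12\varepsilon_{abcd}F^{cd}$. Let $F$ be a nowhere-vanishing smooth 2-form on $M$ satisfying the vacuum Maxwell equations $dF=0$ and $d(\star F)=0$. Suppose that $F$ is simple, i.e. there are smooth 1-forms $\omega^1,\omega^2,\tau^1,\tau^2$ on $M$ with $$F=\omega^1\wedge\omega^2,\qquad \star F=\tau^1\wedge\tau^2 .$$ Then $D_1=\ker\omega^1\cap\ker\omega^2$ and $D_2=\ker\tau^1\cap\ker\tau^2$ are smooth involutive rank-2 distributions on $M$. There is exactly one smooth foliation $\mathcal F_1$ of $M$ of codimension 2 whose leaves are integral manifolds of $D_1$ (the "magnetic leaves"), and exactly one smooth foliation $\mathcal F_2$ of codimension 2 whose leaves are integral manifolds of $D_2$ (the "electric leaves"). The foliations $\mathcal F_1,\mathcal F_2$ form a $(2,2)$-dual foliation of $(M,g)$: they are the foliations defined by the nowhere-vanishing simple closed 2-forms $\omega^1\wedge\omega^2$ and $\tau^1\wedge\tau^2=\star(\omega^1\wedge\omega^2)$.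 They are mutually orthogonal: $g_p(u,v)=0$ for all $p\in M$, $u\in D_1(p)$, $v\in D_2(p)$. Here a smooth $k$-dimensional foliation of an $m$-dimensional manifold $M$ is a partition of $M$ into connected leaves (connected as immersed submanifolds, which is the same as path-connected in $M$) such that every point of $M$ lies in the domain $U$ of a smooth chart $(x^1,\dots,x^m)$ for which the connected components of $U\cap L$, for each leaf $L$, are given by equations $x^{k+1}=\mathrm{const},\dots,x^m=\mathrm{const}$. Its leaves are integral manifolds of a distribution $D$ if around every point such a chart can be chosen with $D_q=\ker dx^{k+1}_q\cap\dots\cap\ker dx^m_q$ for all $q\in U$. -/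

import Mathlib

open scoped Manifold ContDiff Topology

noncomputable section

namespace Spacetime

/-! ### Differential forms on a manifold without boundary -/

/-- The wedge product `α ∧ β` of two covectors:
`(α ∧ β)(v₀, v₁) = α v₀ * β v₁ - α v₁ * β v₀`. -/
def covectorWedge {V : Type*} [AddCommGroup V] [Module ℝ V] [TopologicalSpace V]
    (α β : V →L[ℝ] ℝ) : V [⋀^Fin 2]→L[ℝ] ℝ where
  toFun v := α (v 0) * β (v 1) - α (v 1) * β (v 0)
  map_update_add' v i x y := by
    fin_cases i <;> simp [Function.update] <;> ring
  map_update_smul' v i c x := by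
    fin_cases i <;> simp [Function.update] <;> ring
  map_eq_zero_of_eq' v i j h hij := by
    fin_cases i <;> fin_cases j <;> simp_all
  cont := by fun_prop

/-- A (not necessarily smooth) field of covectors on the `m`-dimensional manifold `M`. -/
abbrev OneForm (m : ℕ) (M : Type*) [TopologicalSpace M]
    [ChartedSpace (EuclideanSpace ℝ (Fin m)) M] :=
  ∀ p : M, TangentSpace (𝓡 m) p →L[ℝ] ℝ

/-- A (not necessarily smooth) field of alternating `k`-linear forms on the `m`-dimensional
manifold `M`. -/
abbrev DiffForm (m k : ℕ) (M : Type*) [TopologicalSpace M]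
    [ChartedSpace (EuclideanSpace ℝ (Fin m)) M] :=
  ∀ p : M, TangentSpace (𝓡 m) p [⋀^Fin k]→L[ℝ] ℝ

section Forms

variable {m k : ℕ} {M : Type*} [TopologicalSpace M] [ChartedSpace (EuclideanSpace ℝ (Fin m)) M]

/-- The coordinate expression of a 1-form in a chart `φ`, i.e. its pullback under `φ⁻¹`;
it is meaningful on `φ.target`. -/
def OneForm.inChart (α : OneForm m M) (φ : OpenPartialHomeomorph M (EuclideanSpace ℝ (Fin m)))
    (y : EuclideanSpace ℝ (Fin m)) : EuclideanSpace ℝ (Fin m) →L[ℝ] ℝ :=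
  (α (φ.symm y)).comp (mfderiv 𝓘(ℝ, EuclideanSpace ℝ (Fin m)) (𝓡 m) φ.symm y)

/-- A smooth 1-form: its coordinate expressions are smooth. -/
def OneForm.Smooth (α : OneForm m M) : Prop :=
  ∀ φ ∈ atlas (EuclideanSpace ℝ (Fin m)) M, ContDiffOn ℝ ∞ (α.inChart φ) φ.target

/-- The coordinate expression of a `k`-form in a chart `φ`, i.e. its pullback under `φ⁻¹`;
it is meaningful on `φ.target`. -/
def DiffForm.inChart (η : DiffForm m k M)
    (φ : OpenPartialHomeomorph M (EuclideanSpace ℝ (Fin m))) (y : EuclideanSpace ℝ (Fin m)) :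
    EuclideanSpace ℝ (Fin m) [⋀^Fin k]→L[ℝ] ℝ :=
  (η (φ.symm y)).compContinuousLinearMap
    (mfderiv 𝓘(ℝ, EuclideanSpace ℝ (Fin m)) (𝓡 m) φ.symm y)

/-- A smooth `k`-form: its coordinate expressions are smooth. -/
def DiffForm.Smooth (η : DiffForm m k M) : Prop :=
  ∀ φ ∈ atlas (EuclideanSpace ℝ (Fin m)) M, ContDiffOn ℝ ∞ (η.inChart φ) φ.target

/-- `dη = 0`: in every chart of the atlas the exterior derivative of the coordinate expression
of `η` vanishes. -/
def DiffForm.Closed (η : DiffForm m k M) : Prop :=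
  ∀ φ ∈ atlas (EuclideanSpace ℝ (Fin m)) M, ∀ y ∈ φ.target, extDeriv (η.inChart φ) y = 0

/-- The wedge product of two 1-forms. -/
def OneForm.wedge (α β : OneForm m M) : DiffForm m 2 M := fun p => covectorWedge (α p) (β p)

/-! ### Distributions and foliations -/

/-- A field of subspaces of the tangent spaces of `M`. -/
abbrev TangentField (m : ℕ) (M : Type*) [TopologicalSpace M]
    [ChartedSpace (EuclideanSpace ℝ (Fin m)) M] :=
  ∀ p : M, Submodule ℝ (TangentSpace (𝓡 m) p)

variable [IsManifold (𝓡 m) ∞ M]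

/-- `V` is a smooth vector field on `U` (its values outside `U` do not matter). -/
def SmoothVectorFieldOn (V : ∀ p : M, TangentSpace (𝓡 m) p) (U : Set M) : Prop :=
  ContMDiffOn (𝓡 m) (𝓡 m).tangent ∞ (fun p => (⟨p, V p⟩ : TangentBundle (𝓡 m) M)) U

/-- A smooth rank-`k` distribution: a field of `k`-dimensional subspaces that is locally spanned
by `k` smooth vector fields. -/
def IsDistribution (k : ℕ) (D : TangentField m M) : Prop :=
  (∀ p, Module.finrank ℝ (D p) = k) ∧
  ∀ p, ∃ U : Set M, IsOpen U ∧ p ∈ U ∧ ∃ V : Fin k → ∀ q : M, TangentSpace (𝓡 m) q,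
    (∀ i, SmoothVectorFieldOn (V i) U) ∧
    ∀ q ∈ U, D q = Submodule.span ℝ (Set.range fun i => V i q)

/-- Involutivity: the Lie bracket of two local smooth sections of `D` is a section of `D`. -/
def IsInvolutive (D : TangentField m M) : Prop :=
  ∀ U : Set M, IsOpen U → ∀ V W : ∀ p : M, TangentSpace (𝓡 m) p,
    SmoothVectorFieldOn V U → SmoothVectorFieldOn W U →
    (∀ p ∈ U, V p ∈ D p) → (∀ p ∈ U, W p ∈ D p) →
    ∀ p ∈ U, VectorField.mlieBracket (𝓡 m) V W p ∈ D p

/-- `φ` is a smooth chart of `M` distinguished by the family of leaves `ℱ`: for every leaf `L`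
the connected components of `φ.source ∩ L` are given by equations
`x^{k+1} = const, …, x^m = const` (coordinates are numbered from `0` here). -/
def IsDistinguishedChart (k : ℕ) (ℱ : Set (Set M))
    (φ : OpenPartialHomeomorph M (EuclideanSpace ℝ (Fin m))) : Prop :=
  φ ∈ IsManifold.maximalAtlas (𝓡 m) ∞ M ∧
  ∀ L ∈ ℱ, ∀ p ∈ φ.source ∩ L,
    connectedComponentIn (φ.source ∩ L) p =
      {q ∈ φ.source | ∀ i : Fin m, k ≤ (i : ℕ) → φ q i = φ p i}

/-- A smooth `k`-dimensional foliation of `M`: a partition of `M` into connected leaves such that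
`M` is covered by distinguished charts. Leaves are required to be path-connected in `M`; since a
continuous path inside a leaf stays, locally, in a single plaque of a distinguished chart, this
says that a leaf is connected as an immersed submanifold (in particular it is a connected subset
of `M`). -/
def IsFoliation (k : ℕ) (ℱ : Set (Set M)) : Prop :=
  Setoid.IsPartition ℱ ∧ (∀ L ∈ ℱ, IsPathConnected L) ∧
  ∀ p : M, ∃ φ : OpenPartialHomeomorph M (EuclideanSpace ℝ (Fin m)),
    p ∈ φ.source ∧ IsDistinguishedChart k ℱ φ

/-- The leaves of `ℱ` are integral manifolds of `D`: around every point there is a distinguished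
chart in which the tangent spaces of the plaques, i.e. the common kernels of
`dx^{k+1}, …, dx^m`, are the subspaces `D q`. -/
def IsTangentTo (k : ℕ) (ℱ : Set (Set M)) (D : TangentField m M) : Prop :=
  ∀ p : M, ∃ φ : OpenPartialHomeomorph M (EuclideanSpace ℝ (Fin m)),
    p ∈ φ.source ∧ IsDistinguishedChart k ℱ φ ∧
    ∀ q ∈ φ.source, ∀ v : TangentSpace (𝓡 m) q, v ∈ D q ↔
      ∀ i : Fin m, k ≤ (i : ℕ) →
        mfderiv (𝓡 m) 𝓘(ℝ, ℝ) (fun x : M => φ x i) q v = (0 : ℝ)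

/-- `ℱ` is a `k`-dimensional foliation whose leaves are integral manifolds of `D`. -/
def IsFoliationOf (k : ℕ) (D : TangentField m M) (ℱ : Set (Set M)) : Prop :=
  IsFoliation (m := m) k ℱ ∧ IsTangentTo k ℱ D

/-- The field of subspaces `ker α ∩ ker β`. -/
def kerInter (α β : OneForm m M) : TangentField m M := fun p =>
  LinearMap.ker (α p).toLinearMap ⊓ LinearMap.ker (β p).toLinearMap

end Forms

/-! ### Lorentzian metrics and the Hodge star on 2-forms -/

/-- A smooth Lorentzian metric of signature `(+,-,-,-)` on the 4-dimensional manifold `M`. -/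
structure LorentzMetric (M : Type*) [TopologicalSpace M]
    [ChartedSpace (EuclideanSpace ℝ (Fin 4)) M] [IsManifold (𝓡 4) ∞ M] where
  /-- The scalar product on each tangent space. -/
  inner (p : M) : TangentSpace (𝓡 4) p →L[ℝ] TangentSpace (𝓡 4) p →L[ℝ] ℝ
  symm (p : M) (v w : TangentSpace (𝓡 4) p) : inner p v w = inner p w v
  signature (p : M) : ∃ b : Module.Basis (Fin 4) ℝ (TangentSpace (𝓡 4) p),
    ∀ i j, inner p (b i) (b j) = if i = j then (if i = 0 then 1 else -1) else 0
  contMDiff : ContMDiff (𝓡 4)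
    ((𝓡 4).prod 𝓘(ℝ, EuclideanSpace ℝ (Fin 4) →L[ℝ] EuclideanSpace ℝ (Fin 4) →L[ℝ] ℝ)) ∞
    (fun p => Bundle.TotalSpace.mk'
      (EuclideanSpace ℝ (Fin 4) →L[ℝ] EuclideanSpace ℝ (Fin 4) →L[ℝ] ℝ)
      (E := fun p : M => TangentSpace (𝓡 4) p →L[ℝ] TangentSpace (𝓡 4) p →L[ℝ] ℝ) p (inner p))

section Hodge

variable {M : Type*} [TopologicalSpace M] [ChartedSpace (EuclideanSpace ℝ (Fin 4)) M]

/-- The vectors `e_a = ∂/∂x^a` at `p`, for the coordinates given by the preferred chart at `p`. -/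
def coordVector (p : M) (a : Fin 4) : TangentSpace (𝓡 4) p :=
  (EuclideanSpace.single a (1 : ℝ) : EuclideanSpace ℝ (Fin 4))

/-- The covectors `dx^a` at `p`, for the coordinates given by the preferred chart at `p`. -/
def coordCovector (p : M) (a : Fin 4) : TangentSpace (𝓡 4) p →L[ℝ] ℝ :=
  (EuclideanSpace.proj a : EuclideanSpace ℝ (Fin 4) →L[ℝ] ℝ)

variable [IsManifold (𝓡 4) ∞ M]

/-- `ε` is a volume form of `(M, g)`, i.e. the metric volume form for one of the orientations of
`M`: a smooth 4-form whose square on four tangent vectors is the absolute value of their Gram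
determinant. -/
def LorentzMetric.IsVolumeForm (g : LorentzMetric M) (ε : DiffForm 4 4 M) : Prop :=
  ε.Smooth ∧ ∀ (p : M) (v : Fin 4 → TangentSpace (𝓡 4) p),
    (ε p v) ^ 2 = |(Matrix.of fun i j => g.inner p (v i) (v j)).det|

/-- The components `g_{ab}` of the metric. -/
def LorentzMetric.gram (g : LorentzMetric M) (p : M) : Matrix (Fin 4) (Fin 4) ℝ :=
  Matrix.of fun a b => g.inner p (coordVector p a) (coordVector p b)

/-- The components `F^{ab} = g^{ac} g^{bd} F_{cd}` of a 2-form with raised indices. -/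
def LorentzMetric.raise (g : LorentzMetric M) (F : DiffForm 4 2 M) (p : M) (a b : Fin 4) : ℝ :=
  ∑ c, ∑ d, (g.gram p)⁻¹ a c * (g.gram p)⁻¹ b d * F p ![coordVector p c, coordVector p d]

/-- The Hodge star of a 2-form, `⋆F = ½ (⋆F)_{ab} dx^a ∧ dx^b` with
`(⋆F)_{ab} = ½ ε_{abcd} F^{cd}`. -/
def LorentzMetric.hodgeStar (g : LorentzMetric M) (ε : DiffForm 4 4 M) (F : DiffForm 4 2 M) :
    DiffForm 4 2 M := fun p =>
  (1 / 2 : ℝ) • ∑ a, ∑ b,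
    ((1 / 2 : ℝ) * ∑ c, ∑ d,
      ε p ![coordVector p a, coordVector p b, coordVector p c, coordVector p d] *
        g.raise F p c d) •
    covectorWedge (coordCovector p a) (coordCovector p b)

/-- The foliations `ℱ₁`, `ℱ₂` form a `(2,2)`-dual foliation of `(M, g)`: they integrate the
distributions `ker α⁰ ∩ ker α¹` and `ker β⁰ ∩ ker β¹` defined by nowhere-vanishing simple closed
2-forms `α⁰ ∧ α¹` and `β⁰ ∧ β¹` with `β⁰ ∧ β¹ = ⋆(α⁰ ∧ α¹)`. -/
structure IsDualFoliation (g : LorentzMetric M) (ε : DiffForm 4 4 M) (α β : Fin 2 → OneForm 4 M)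
    (ℱ₁ ℱ₂ : Set (Set M)) : Prop where
  smooth_α : ∀ i, (α i).Smooth
  smooth_β : ∀ i, (β i).Smooth
  ne_zero_α : ∀ p, (α 0).wedge (α 1) p ≠ 0
  ne_zero_β : ∀ p, (β 0).wedge (β 1) p ≠ 0
  closed_α : ((α 0).wedge (α 1)).Closed
  closed_β : ((β 0).wedge (β 1)).Closed
  dual : (β 0).wedge (β 1) = g.hodgeStar ε ((α 0).wedge (α 1))
  foliation₁ : IsFoliationOf 2 (kerInter (α 0) (α 1)) ℱ₁
  foliation₂ : IsFoliationOf 2 (kerInter (β 0) (β 1)) ℱ₂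

end Hodge

end Spacetime

end

/-! Why the kernels are involutive: if `V`, `W` are sections of the kernel of a closed 2-form `F`
and `c` is any constant field in a chart, every term of the invariant formula for `dF(V, W, c)`
vanishes except `F([V, W], c)`. Hence `[V, W]` lies in the kernel of `F`, which for `F = a ∧ b ≠ 0`
is `ker a ∩ ker b` (`lieBracket_mem_ker_of_extDeriv_eq_zero`).

Local Frobenius theorem: near a point the kernel is the graph of some `A : X × Y → (X →L Y)`, and
involutivity becomes the integrability condition of `∂Φ/∂x = A (x, Φ)`. This equation is solved
along rays from `x = 0` as an integral equation in the Banach space `C([0,1], Y)`. The inverse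
function theorem there gives smooth dependence on `(x, y)`, and integrability shows that the
solution along rays solves the equation in all directions (`exists_solution_totalDifferential`). The
solution yields charts in which the distribution is `dx² = dx³ = 0`.

Global foliation: leaves are the classes of the relation generated by lying in a common plaque. The
crux is that a plaque is a whole connected component of chart ∩ leaf. By second countability a leaf
meets a chart in countably many plaques (`countable_transverse_image_leaf`), and a connected
countable subset of `ℝ` is a point. For uniqueness, a path inside a leaf of one foliation stays
locally, hence globally, inside a leaf of the other.

Duality: `⋆(α ∧ β) = ε(·, ·, ♯α, ♯β)`, so the kernel of the dual form lies in the span of `♯α`,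
`♯β`. Since `g(u, ♯α) = α(u)`, it is orthogonal to `ker α ∩ ker β`. The same formula shows that `⋆F`
vanishes nowhere, so both distributions are treated alike. -/

noncomputable section

namespace Spacetime

/-! ### Superposition operators on spaces of continuous functions -/

section Superposition

universe u

variable {K : Type*} [TopologicalSpace K] [CompactSpace K]

/-- Pointwise evaluation of a continuous family of continuous linear maps. -/
def pointwiseApply {V W : Type*} [NormedAddCommGroup V] [NormedSpace ℝ V]
    [NormedAddCommGroup W] [NormedSpace ℝ W] :
    C(K, V →L[ℝ] W) →L[ℝ] C(K, V) →L[ℝ] C(K, W) :=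
  LinearMap.mkContinuous₂
    (LinearMap.mk₂ ℝ (fun (A : C(K, V →L[ℝ] W)) (h : C(K, V)) =>
        (⟨fun k => A k (h k), by fun_prop⟩ : C(K, W)))
      (fun A₁ A₂ h => by ext k; simp) (fun c A h => by ext k; simp)
      (fun A h₁ h₂ => by ext k; simp) (fun c A h => by ext k; simp)) 1 fun A h => by
    rw [one_mul, ContinuousMap.norm_le _ (by positivity)]
    intro k
    exact ((A k).le_opNorm _).trans
      (mul_le_mul (A.norm_coe_le_norm k) (h.norm_coe_le_norm k) (by positivity) (by positivity))

/-- The superposition operator of a `C^1` map is differentiable. -/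
theorem hasFDerivAt_comp {V W : Type*} [NormedAddCommGroup V] [NormedSpace ℝ V]
    [NormedAddCommGroup W] [NormedSpace ℝ W] (f : C(V, W)) (f' : C(V, V →L[ℝ] W))
    (hf : ∀ x, HasFDerivAt f (f' x) x) (u : C(K, V)) :
    HasFDerivAt (fun u : C(K, V) => f.comp u) (pointwiseApply (f'.comp u)) u := by
  rw [hasFDerivAt_iff_isLittleO_nhds_zero, Asymptotics.isLittleO_iff]
  intro c hc
  have hcont : ContinuousAt (fun h : C(K, V) => f'.comp (u + h)) 0 := by
    have := ContinuousMap.continuous_postcomp (X := K) f'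
    exact (this.comp (continuous_const.add continuous_id)).continuousAt
  -- Continuity of `u ↦ f' ∘ u` in the sup norm provides one `δ` for all points of `K`, so the mean
  -- value estimate below is uniform in `k`.
  obtain ⟨δ, hδ, H⟩ := (Metric.continuousAt_iff (α := C(K, V)) (β := C(K, V →L[ℝ] W))).1 hcont c hc
  filter_upwards [Metric.ball_mem_nhds (0 : C(K, V)) hδ] with h hh
  rw [ContinuousMap.norm_le _ (by positivity)]
  intro k
  have hseg : ∀ s ∈ Set.Icc (0 : ℝ) 1, ‖f' (u k + s • h k) - f' (u k)‖ ≤ c := by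
    intro s hs
    have h1 : dist (s • h) 0 < δ := by
      rw [dist_zero_right, norm_smul, Real.norm_of_nonneg hs.1]
      rw [Metric.mem_ball, dist_zero_right] at hh
      exact (mul_le_of_le_one_left (norm_nonneg _) hs.2).trans_lt hh
    have h2 := (H h1).le
    have h3 := (ContinuousMap.dist_le hc.le).1 h2 k
    simpa [dist_eq_norm] using h3
  have key : ‖(fun s : ℝ => f (u k + s • h k) - s • f' (u k) (h k)) 1 -
      (fun s : ℝ => f (u k + s • h k) - s • f' (u k) (h k)) 0‖ ≤ (c * ‖h k‖) * ‖(1 : ℝ) - 0‖ := by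
    refine (convex_Icc (0 : ℝ) 1).norm_image_sub_le_of_norm_hasDerivWithin_le
      (f := fun s : ℝ => f (u k + s • h k) - s • f' (u k) (h k))
      (f' := fun s => f' (u k + s • h k) (h k) - f' (u k) (h k)) ?_ ?_
      (Set.left_mem_Icc.2 zero_le_one) (Set.right_mem_Icc.2 zero_le_one)
    · intro s _
      have h1 : HasDerivAt (fun s : ℝ => u k + s • h k) (h k) s := by
        simpa using ((hasDerivAt_id s).smul_const (h k)).const_add (u k)
      have h2 : HasDerivAt (fun s : ℝ => s • f' (u k) (h k)) (f' (u k) (h k)) s := by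
        simpa using (hasDerivAt_id s).smul_const (f' (u k) (h k))
      exact (((hf _).comp_hasDerivAt s h1).sub h2).hasDerivWithinAt
    · intro s hs
      rw [← sub_apply]
      exact (ContinuousLinearMap.le_opNorm _ _).trans
        (mul_le_mul_of_nonneg_right (hseg s hs) (norm_nonneg _))
  have h4 : ‖f (u k + h k) - f (u k) - f' (u k) (h k)‖ ≤ c * ‖h k‖ := by
    simpa [sub_right_comm] using key
  exact h4.trans (mul_le_mul_of_nonneg_left (h.norm_coe_le_norm k) hc.le)

/-- The derivative of the superposition by `f` is the superposition by `fderiv ℝ f` followed by a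
bounded linear map, so induction applies. The target changes from `W` to `V →L[ℝ] W` at each step:
hence `W` is quantified inside the induction and both spaces share a universe. -/
theorem contDiff_nat_comp {V : Type u} [NormedAddCommGroup V] [NormedSpace ℝ V] (n : ℕ) :
    ∀ {W : Type u} [NormedAddCommGroup W] [NormedSpace ℝ W] (f : C(V, W)), ContDiff ℝ ∞ f →
      ContDiff ℝ n (fun u : C(K, V) => f.comp u) := by
  induction n with
  | zero => 
    intro W _ _ f _
    exact contDiff_zero.2 (ContinuousMap.continuous_postcomp f)
  | succ n ih =>
    intro W _ _ f hf
    have hf' : ContDiff ℝ ∞ (fderiv ℝ f) := hf.fderiv_right (by simp)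
    refine (contDiff_succ_iff_hasFDerivAt (n := n)).2
      ⟨_, ?_, hasFDerivAt_comp f ⟨fderiv ℝ f, hf'.continuous⟩
        fun x => (hf.differentiable (by simp) x).hasFDerivAt⟩
    exact pointwiseApply.contDiff.comp (ih ⟨fderiv ℝ f, hf'.continuous⟩ hf')

/-- The superposition operator `u ↦ f ∘ u` of a smooth map is smooth. -/
theorem contDiff_comp {V W : Type u} [NormedAddCommGroup V] [NormedSpace ℝ V]
    [NormedAddCommGroup W] [NormedSpace ℝ W] (f : C(V, W)) (hf : ContDiff ℝ ∞ f) :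
    ContDiff ℝ ∞ (fun u : C(K, V) => f.comp u) :=
  contDiff_infty.2 fun n => contDiff_nat_comp n f hf

end Superposition

/-! ### Integration along the unit interval and local inverses of smooth maps. -/

/-- The integration operator `u ↦ (t ↦ ∫₀ᵗ u)`. -/
def primitive {Y : Type*} [NormedAddCommGroup Y] [NormedSpace ℝ Y] [CompleteSpace Y] :
    C(unitInterval, Y) →L[ℝ] C(unitInterval, Y) :=
  LinearMap.mkContinuous
    { toFun := fun u => ⟨fun t => ∫ s in (0 : ℝ)..t, Set.IccExtend zero_le_one u s,
        (intervalIntegral.continuous_primitive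
          (fun a b => (u.continuous.Icc_extend' : Continuous (Set.IccExtend zero_le_one u)).intervalIntegrable a b) 0).comp
          continuous_subtype_val⟩
      map_add' := fun u v => by
        ext t
        exact intervalIntegral.integral_add
          ((u.continuous.Icc_extend' : Continuous (Set.IccExtend zero_le_one u)).intervalIntegrable _ _)
          ((v.continuous.Icc_extend' : Continuous (Set.IccExtend zero_le_one v)).intervalIntegrable _ _)
      map_smul' := fun c u => by
        ext t
        exact intervalIntegral.integral_smul c _ } 1 fun u => by
    rw [one_mul, ContinuousMap.norm_le _ (norm_nonneg _)]
    intro t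
    refine (intervalIntegral.norm_integral_le_of_norm_le_const
      (C := ‖u‖) fun s _ => u.norm_coe_le_norm _).trans ?_
    rw [sub_zero, abs_of_nonneg t.2.1]
    exact mul_le_of_le_one_right (norm_nonneg _) t.2.2

lemma primitive_apply {Y : Type*} [NormedAddCommGroup Y] [NormedSpace ℝ Y] [CompleteSpace Y]
    (u : C(unitInterval, Y)) (t : unitInterval) :
    primitive u t = ∫ s in (0 : ℝ)..t, Set.IccExtend zero_le_one u s := rfl

/-- **Inverse function theorem** for a smooth map on an open set: the local inverse is smooth on
a whole neighbourhood. -/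
theorem exists_smooth_local_inverse {E F : Type*} [NormedAddCommGroup E] [NormedSpace ℝ E]
    [CompleteSpace E] [NormedAddCommGroup F] [NormedSpace ℝ F] {f : E → F} {Ω : Set E}
    (hΩ : IsOpen Ω) (hf : ContDiffOn ℝ ∞ f Ω) {a : E} (ha : a ∈ Ω) (f' : E ≃L[ℝ] F)
    (hfa : HasFDerivAt f (f' : E →L[ℝ] F) a) :
    ∃ e : OpenPartialHomeomorph E F, a ∈ e.source ∧ e.source ⊆ Ω ∧ ⇑e = f ∧
      ContDiffOn ℝ ∞ e.symm e.target ∧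
      ∀ x ∈ e.source, ∃ g : E ≃L[ℝ] F, (g : E →L[ℝ] F) = fderiv ℝ f x := by
  have hfat : ∀ x ∈ Ω, ContDiffAt ℝ ∞ f x := fun x hx => hf.contDiffAt (hΩ.mem_nhds hx)
  -- Restricting to points with invertible derivative makes the inverse smooth on its whole domain,
  -- not only at the image of `a`.
  have hS : IsOpen (Ω ∩ fderiv ℝ f ⁻¹' Set.range ((↑) : (E ≃L[ℝ] F) → E →L[ℝ] F)) := by
    have h1 : ContinuousOn (fderiv ℝ f) Ω := hf.continuousOn_fderiv_of_isOpen hΩ (by simp)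
    exact h1.isOpen_inter_preimage hΩ ContinuousLinearEquiv.isOpen
  set e₀ := (hfat a ha).toOpenPartialHomeomorph f hfa (by simp)
  have hmem : a ∈ Ω ∩ fderiv ℝ f ⁻¹' Set.range ((↑) : (E ≃L[ℝ] F) → E →L[ℝ] F) :=
    ⟨ha, f', hfa.fderiv.symm⟩
  refine ⟨e₀.restrOpen _ hS, ⟨(hfat a ha).mem_toOpenPartialHomeomorph_source hfa (by simp), hmem⟩,
    fun x hx => hx.2.1, rfl, ?_, fun x hx => ?_⟩
  · intro y hy
    set e := e₀.restrOpen _ hS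
    have hx : e.symm y ∈ e.source := e.map_target hy
    obtain ⟨g, hg⟩ := hx.2.2
    have hd : HasFDerivAt e (g : E →L[ℝ] F) (e.symm y) := by
      rw [hg]
      exact ((hfat _ hx.2.1).differentiableAt (by simp)).hasFDerivAt
    exact (e.contDiffAt_symm hy hd (hfat _ hx.2.1)).contDiffWithinAt
  · exact hx.2.2

/-! ### Total differential equations -/

section TotalDifferential

variable {X Y : Type} [NormedAddCommGroup X] [NormedSpace ℝ X]
  [NormedAddCommGroup Y] [NormedSpace ℝ Y]

/-- The inclusion of `Y` as constant paths. -/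
def constPath : Y →L[ℝ] C(unitInterval, Y) :=
  LinearMap.mkContinuous
    { toFun := fun y => ContinuousMap.const _ y
      map_add' := fun _ _ => rfl
      map_smul' := fun _ _ => rfl } 1 fun y => by
    rw [one_mul, ContinuousMap.norm_le _ (norm_nonneg _)]
    exact fun _ => le_rfl

@[simp] lemma constPath_apply (y : Y) (t : unitInterval) : constPath y t = y := rfl

/-- The path `t ↦ ((t x, u t), x)`, depending linearly on `x` and the path `u`. -/
def rayLift : X × C(unitInterval, Y) →L[ℝ] C(unitInterval, (X × Y) × X) :=
  LinearMap.mkContinuous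
    { toFun := fun q => ⟨fun t => (((t : ℝ) • q.1, q.2 t), q.1), by fun_prop⟩
      map_add' := fun q₁ q₂ => by ext t <;> simp
      map_smul' := fun c q => by ext t <;> simp [smul_comm (_ : ℝ) c] } 1 fun q => by
    rw [one_mul, ContinuousMap.norm_le _ (norm_nonneg _)]
    intro t
    refine max_le (max_le ?_ ?_) (norm_fst_le q)
    · change ‖(t : ℝ) • q.1‖ ≤ _
      rw [norm_smul, Real.norm_of_nonneg t.2.1]
      exact (mul_le_of_le_one_left (norm_nonneg _) t.2.2).trans (norm_fst_le q)
    · exact (q.2.norm_coe_le_norm t).trans (norm_snd_le q)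

@[simp] lemma rayLift_apply (q : X × C(unitInterval, Y)) (t : unitInterval) :
    rayLift q t = (((t : ℝ) • q.1, q.2 t), q.1) := rfl

variable [CompleteSpace Y]

/-- The right hand side of the integral equation `u t = y + ∫₀ᵗ A (s x, u s) x` of the total
differential equation `∂u/∂x = A (x, u)` along the ray through `x`. -/
def rayIntegral (f : C((X × Y) × X, Y)) (q : X × C(unitInterval, Y)) : C(unitInterval, Y) :=
  primitive (f.comp (rayLift q))

lemma contDiff_rayIntegral (f : C((X × Y) × X, Y)) (hf : ContDiff ℝ ∞ f) :
    ContDiff ℝ ∞ (rayIntegral f) :=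
  ContDiff.comp (ContinuousLinearMap.contDiff (E := C(unitInterval, Y)) (F := C(unitInterval, Y))
    primitive) (ContDiff.comp (contDiff_comp f hf) (ContinuousLinearMap.contDiff
      (E := X × C(unitInterval, Y)) (F := C(unitInterval, (X × Y) × X)) rayLift))

/-- Chain rule through the linear maps `rayLift` and `primitive`. The integrand enters as a path `w`
with prescribed values, so that each use can supply its own continuous representative. -/
lemma fderiv_rayIntegral (f : C((X × Y) × X, Y)) (hf : ContDiff ℝ ∞ f)
    (q r : X × C(unitInterval, Y)) (w : C(unitInterval, Y))
    (hw : ∀ t, w t = fderiv ℝ f (rayLift q t) (rayLift r t)) :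
    fderiv ℝ (rayIntegral f) q r = primitive w := by
  have hf' : ContDiff ℝ ∞ (fderiv ℝ f) := hf.fderiv_right (by simp)
  have h := (primitive (Y := Y)).hasFDerivAt.comp q
    ((hasFDerivAt_comp f ⟨fderiv ℝ f, hf'.continuous⟩
      (fun x => (hf.differentiable (by simp) x).hasFDerivAt) (rayLift q)).comp q
        (rayLift (X := X) (Y := Y)).hasFDerivAt)
  have h' : fderiv ℝ (rayIntegral f) q = _ := h.fderiv
  rw [h']
  change primitive _ = primitive w
  congr 1
  ext t
  rw [hw]
  rfl

/-- The solution of the integral equation satisfies the linearised integral equation with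
derivative `t A (t x, u t) v`, provided the integrability condition holds along the ray. -/
lemma linearised_rayIntegral {A : X × Y → X →L[ℝ] Y} (hA : ContDiff ℝ ∞ A)
    (f : C((X × Y) × X, Y)) (hf : ∀ p, f p = A p.1 p.2) {x v : X} {y : Y}
    {u T : C(unitInterval, Y)} (hu : u = constPath y + rayIntegral f (x, u))
    (hT : ∀ t : unitInterval, T t = (t : ℝ) • A ((t : ℝ) • x, u t) v)
    (hI : ∀ t : unitInterval, fderiv ℝ A ((t : ℝ) • x, u t) (x, A ((t : ℝ) • x, u t) x) v =
      fderiv ℝ A ((t : ℝ) • x, u t) (v, A ((t : ℝ) • x, u t) v) x) :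
    T = fderiv ℝ (rayIntegral f) (x, u) (v, T) := by
  have hfA : ⇑f = fun p : (X × Y) × X => A p.1 p.2 := funext hf
  have hAd : ∀ z, HasFDerivAt A (fderiv ℝ A z) z :=
    fun z => (hA.differentiable (by simp) z).hasFDerivAt
  have hfs : ContDiff ℝ ∞ f := by
    rw [hfA]; exact (hA.comp contDiff_fst).clm_apply contDiff_snd
  have hf' : ContDiff ℝ ∞ (fderiv ℝ f) := hfs.fderiv_right (by simp)
  have hfd : ∀ (z ζ : X × Y) (ξ η : X), fderiv ℝ f (z, ξ) (ζ, η) = fderiv ℝ A z ζ ξ + A z η := by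
    intro z ζ ξ η
    have h1 : HasFDerivAt (fun p : (X × Y) × X => A p.1) ((fderiv ℝ A z).comp
        (ContinuousLinearMap.fst ℝ (X × Y) X)) (z, ξ) :=
      (hAd z).comp (z, ξ) hasFDerivAt_fst
    have h2 := h1.clm_apply (hasFDerivAt_snd (p := (z, ξ)))
    rw [hfA, h2.fderiv]
    simp [add_comm]
  let w : C(unitInterval, Y) :=
    ⟨fun t => fderiv ℝ f (rayLift (x, u) t) (rayLift (v, T) t), by
      have := hf'.continuous
      fun_prop⟩
  rw [fderiv_rayIntegral f hfs (x, u) (v, T) w fun _ => rfl]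
  ext t
  rw [primitive_apply]
  let z : ℝ → X × Y := fun s => (s • x, Set.IccExtend zero_le_one u s)
  -- The integral equation is differentiated on the open interval only: outside `[0,1]` the
  -- extension of `u` is constant and the equation fails.
  have hud : ∀ s ∈ Set.Ioo (0 : ℝ) 1, HasDerivAt (Set.IccExtend zero_le_one u) (A (z s) x) s := by
    intro s hs
    have h1 : HasDerivAt (fun t => y + ∫ s in (0 : ℝ)..t,
        Set.IccExtend zero_le_one (f.comp (rayLift (x, u))) s)
        (Set.IccExtend zero_le_one (f.comp (rayLift (x, u))) s) s := by
      have hc := ((f.comp (rayLift (x, u))).continuous.Icc_extend' :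
        Continuous (Set.IccExtend zero_le_one (f.comp (rayLift (x, u)))))
      exact (intervalIntegral.integral_hasDerivAt_right (hc.intervalIntegrable _ _)
        (hc.stronglyMeasurableAtFilter _ _) hc.continuousAt).const_add y
    have hsI : s ∈ Set.Icc (0 : ℝ) 1 := ⟨hs.1.le, hs.2.le⟩
    have h2 : Set.IccExtend zero_le_one (f.comp (rayLift (x, u))) s = A (z s) x := by
      rw [Set.IccExtend_of_mem _ _ hsI]
      simp only [z, Set.IccExtend_of_mem _ _ hsI]
      exact hf _
    rw [h2] at h1
    refine h1.congr_of_eventuallyEq ?_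
    filter_upwards [Icc_mem_nhds hs.1 hs.2] with r hr
    rw [Set.IccExtend_of_mem _ _ hr]
    conv_lhs => rw [hu]
    rfl
  -- The derivative of `s • A (z s) v` is `A v + s dA(x, A x) v`. Integrability exchanges `x` and
  -- `v` in the second term, which gives exactly the integrand `w`.
  have key := intervalIntegral.integral_eq_sub_of_hasDerivAt_of_le (a := 0) (b := (t : ℝ)) t.2.1
    (f := fun s => s • A (z s) v) (f' := Set.IccExtend zero_le_one w) ?_ ?_ ?_
  · rw [key, hT]
    simp only [z, Set.IccExtend_val, zero_smul, sub_zero]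
  · have := hA.continuous
    fun_prop
  · intro s hs
    have hs1 : s ∈ Set.Ioo (0 : ℝ) 1 := ⟨hs.1, hs.2.trans_le t.2.2⟩
    have hsI : s ∈ Set.Icc (0 : ℝ) 1 := ⟨hs1.1.le, hs1.2.le⟩
    have hz : HasDerivAt z (x, A (z s) x) s := by
      refine HasDerivAt.prodMk ?_ (hud s hs1)
      simpa using (hasDerivAt_id s).smul_const x
    have h1 : HasDerivAt (fun s => A (z s) v) (fderiv ℝ A (z s) (x, A (z s) x) v) s := by
      have := ((hAd (z s)).comp_hasDerivAt s hz).clm_apply (hasDerivAt_const s v)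
      simpa using this
    have h2 := (hasDerivAt_id s).smul h1
    refine h2.congr_deriv ?_
    have hzs : z s = ((((⟨s, hsI⟩ : unitInterval) : ℝ)) • x, u ⟨s, hsI⟩) := by
      simp only [z, Set.IccExtend_of_mem _ _ hsI]
    rw [Set.IccExtend_of_mem _ _ hsI]
    change _ = fderiv ℝ f ((((s : ℝ) • x, u ⟨s, hsI⟩), x)) (((s • v), T ⟨s, hsI⟩), v)
    have hI' := hI ⟨s, hsI⟩
    have hT' := hT ⟨s, hsI⟩
    simp only at hI' hT'
    have hz' : z s = (s • x, u ⟨s, hsI⟩) := hzs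
    rw [hfd, hT', ← hz'] 
    rw [← hz'] at hI'
    rw [hI', ← Prod.smul_mk, map_smul]
    simp
  · exact ((w.continuous.Icc_extend' :
      Continuous (Set.IccExtend zero_le_one w))).intervalIntegrable _ _

variable [CompleteSpace X]

/-- **Frobenius theorem**, local version: an integrable total differential equation
`∂Φ/∂x = A (x, Φ)` has solutions with arbitrary initial values `Φ (0, y) = y`, which depend
smoothly on `(x, y)`. -/
theorem exists_solution_totalDifferential {A : X × Y → X →L[ℝ] Y} (hA : ContDiff ℝ ∞ A)
    (hI : ∀ᶠ z in 𝓝 (0 : X × Y), ∀ v w, fderiv ℝ A z (v, A z v) w = fderiv ℝ A z (w, A z w) v) :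
    ∃ (Φ : X × Y → Y) (Ω : Set (X × Y)), IsOpen Ω ∧ (0 : X × Y) ∈ Ω ∧ ContDiffOn ℝ ∞ Φ Ω ∧
      (∀ y, (0, y) ∈ Ω → Φ (0, y) = y) ∧
      ∀ z ∈ Ω, ∀ v, fderiv ℝ Φ z (v, 0) = A (z.1, Φ z) v := by
  have hfs : ContDiff ℝ ∞ fun p : (X × Y) × X => A p.1 p.2 :=
    (hA.comp contDiff_fst).clm_apply contDiff_snd
  let f : C((X × Y) × X, Y) := ⟨fun p => A p.1 p.2, hfs.continuous⟩
  have hN : ContDiff ℝ ∞ (rayIntegral f) := contDiff_rayIntegral f hfs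
  have hN0 : ∀ u, rayIntegral f (0, u) = 0 := by
    intro u
    have : f.comp (rayLift (0, u)) = 0 := by ext t; simp [f]
    rw [rayIntegral, this, map_zero]
  -- The zeros of `G` are the solutions of the integral equation. Adjoining the parameters `(x, y)`
  -- to form `H` turns the implicit function problem into a local inversion.
  let G : (X × Y) × C(unitInterval, Y) → C(unitInterval, Y) :=
    fun p => p.2 - constPath p.1.2 - rayIntegral f (p.1.1, p.2)
  let H : (X × Y) × C(unitInterval, Y) → (X × Y) × C(unitInterval, Y) := fun p => (p.1, G p)
  let ι : (X × Y) × C(unitInterval, Y) →L[ℝ] X × C(unitInterval, Y) :=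
    ((ContinuousLinearMap.fst ℝ X Y).comp (ContinuousLinearMap.fst ℝ _ _)).prod
      (ContinuousLinearMap.snd ℝ _ _)
  let G' : (X × Y) × C(unitInterval, Y) → (X × Y) × C(unitInterval, Y) →L[ℝ] C(unitInterval, Y) :=
    fun p => ContinuousLinearMap.snd ℝ _ _ -
      constPath.comp ((ContinuousLinearMap.snd ℝ X Y).comp (ContinuousLinearMap.fst ℝ _ _)) -
      (fderiv ℝ (rayIntegral f) (ι p)).comp ι
  have hG : ∀ p, HasFDerivAt G (G' p) p := by
    intro p
    have h1 : HasFDerivAt (fun p : (X × Y) × C(unitInterval, Y) => p.2 - constPath p.1.2) _ p :=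
      (ContinuousLinearMap.snd ℝ (X × Y) C(unitInterval, Y) - constPath.comp
        ((ContinuousLinearMap.snd ℝ X Y).comp (ContinuousLinearMap.fst ℝ _ _))).hasFDerivAt
    refine h1.sub ?_
    exact ((hN.differentiable (by simp) (ι p)).hasFDerivAt).comp p ι.hasFDerivAt
  have hH : ∀ p, HasFDerivAt H ((ContinuousLinearMap.fst ℝ _ _).prod (G' p)) p :=
    fun p => hasFDerivAt_fst.prodMk (hG p)
  have hGs : ContDiff ℝ ∞ G := by
    have h1 : ContDiff ℝ ∞ (fun p : (X × Y) × C(unitInterval, Y) => p.2 - constPath p.1.2) :=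
      (ContinuousLinearMap.snd ℝ (X × Y) C(unitInterval, Y) - constPath.comp
        ((ContinuousLinearMap.snd ℝ X Y).comp (ContinuousLinearMap.fst ℝ _ _))).contDiff
    refine h1.sub ?_
    exact hN.comp ι.contDiff
  have hHs : ContDiff ℝ ∞ H := contDiff_fst.prodMk hGs
  -- At `x = 0` the integrand `A (·) 0` is zero for every path, so the integral term has no
  -- first-order dependence on `u`. The partial derivative of `G` in `u` at the origin is therefore
  -- the identity.
  have hN0' : ∀ h : C(unitInterval, Y), fderiv ℝ (rayIntegral f) 0 (0, h) = 0 := by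
    intro h
    rw [fderiv_rayIntegral f hfs 0 (0, h) 0, map_zero]
    intro t
    have h1 : fderiv ℝ f ((0, 0) : (X × Y) × X) (((0 : X), h t), (0 : X)) = 0 := by
      have hd : HasFDerivAt f (fderiv ℝ f ((0, 0) : (X × Y) × X)) (0, 0) :=
        (hfs.differentiable (by simp) _).hasFDerivAt
      have hl : HasFDerivAt (fun z : X × Y => (z, (0 : X))) (ContinuousLinearMap.inl ℝ (X × Y) X)
          (0 : X × Y) := (ContinuousLinearMap.inl ℝ (X × Y) X).hasFDerivAt
      have hc := HasFDerivAt.comp (0 : X × Y) (g := f) (f := fun z : X × Y => (z, (0 : X))) hd hl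
      have hc0 : (f ∘ fun z : X × Y => (z, (0 : X))) = fun _ => 0 := by
        ext z; simp [f]
      rw [hc0] at hc
      have := hc.unique (hasFDerivAt_const 0 0)
      simpa using congrArg (fun L => L ((0 : X), h t)) this
    have h2 : rayLift (0 : X × C(unitInterval, Y)) t = ((0, 0) : (X × Y) × X) := by
      rw [map_zero]; rfl
    have h3 : rayLift ((0 : X), h) t = (((0 : X), h t), (0 : X)) := by simp
    rw [h2, h3, h1]; rfl
  let e' : ((X × Y) × C(unitInterval, Y)) ≃L[ℝ] ((X × Y) × C(unitInterval, Y)) :=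
    ContinuousLinearEquiv.skewProd (ContinuousLinearEquiv.refl ℝ _) (ContinuousLinearEquiv.refl ℝ _)
      ((G' 0).comp (ContinuousLinearMap.inl ℝ _ _))
  have he' : ((ContinuousLinearMap.fst ℝ _ _).prod (G' 0) :
      (X × Y) × C(unitInterval, Y) →L[ℝ] _) = e' := by
    refine ContinuousLinearMap.ext fun p => ?_
    refine Prod.ext rfl ?_
    have h1 : G' 0 p = G' 0 (p.1, 0) + G' 0 (0, p.2) := by rw [← map_add]; simp
    have h2 : G' 0 (0, p.2) = p.2 := by
      have := hN0' p.2
      have h3 : G' 0 (0, p.2) = p.2 - constPath 0 - fderiv ℝ (rayIntegral f) 0 (0, p.2) := rfl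
      rw [h3, this, map_zero, sub_zero, sub_zero]
    change G' 0 p = p.2 + G' 0 (p.1, 0)
    rw [h1, h2, add_comm]
  obtain ⟨e, he0, -, heH, hes, hinv⟩ := exists_smooth_local_inverse isOpen_univ
    hHs.contDiffOn (Set.mem_univ 0) e' (he' ▸ hH 0)
  have heH' : ∀ p, e p = H p := fun p => congrFun heH p
  have hH0 : H 0 = 0 := by
    refine Prod.ext rfl ?_
    simp only [H, G]
    simpa using hN0 0
  have ht0 : (0 : (X × Y) × C(unitInterval, Y)) ∈ e.target := by
    have := e.map_source he0
    rwa [heH', hH0] at this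
  have hs0 : e.symm 0 = 0 := by
    have := e.left_inv he0
    rwa [heH', hH0] at this
  let U : X × Y → C(unitInterval, Y) := fun z => (e.symm (z, 0)).2
  let Ω₀ : Set (X × Y) := {z | (z, (0 : C(unitInterval, Y))) ∈ e.target}
  have hΩ₀ : IsOpen Ω₀ := e.open_target.preimage (by fun_prop)
  have h0Ω₀ : (0 : X × Y) ∈ Ω₀ := ht0
  have hUs : ContDiffOn ℝ ∞ U Ω₀ := by
    refine contDiff_snd.comp_contDiffOn (hes.comp (t := e.target) (s := Ω₀)
      (f := fun z => (z, (0 : C(unitInterval, Y)))) ?_ fun z hz => hz)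
    exact (contDiff_id.prodMk contDiff_const).contDiffOn
  have hU1 : ∀ z ∈ Ω₀, e.symm (z, 0) = (z, U z) := by
    intro z hz
    refine Prod.ext ?_ rfl
    have := e.right_inv hz
    rw [heH'] at this
    have h1 := congrArg Prod.fst this
    exact h1
  have hU2 : ∀ z ∈ Ω₀, U z = constPath z.2 + rayIntegral f (z.1, U z) := by
    intro z hz
    have := e.right_inv hz
    rw [heH', hU1 z hz] at this
    have h2 : U z - constPath z.2 - rayIntegral f (z.1, U z) = 0 := congrArg Prod.snd this
    rw [sub_sub, sub_eq_zero] at h2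
    exact h2
  have hU0 : U 0 = 0 := by
    change (e.symm 0).2 = 0
    rw [hs0]; rfl
  obtain ⟨r, hr, hrI⟩ := Metric.eventually_nhds_iff.1 hI
  -- The sup norm of `U z` bounds all its values, so for `z` in this set the whole curve `t ↦ (t x,
  -- U z t)` stays where integrability holds.
  let Ω : Set (X × Y) := Ω₀ ∩ (fun z => (z.1, U z)) ⁻¹' Metric.ball 0 r
  have hcont : ContinuousOn (fun z : X × Y => (z.1, U z)) Ω₀ :=
    continuousOn_fst.prodMk hUs.continuousOn
  have hΩ : IsOpen Ω := hcont.isOpen_inter_preimage hΩ₀ Metric.isOpen_ball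
  refine ⟨fun z => U z 1, Ω, hΩ, ⟨h0Ω₀, ?_⟩, ?_, ?_, ?_⟩
  · simpa [hU0] using hr
  · exact (ContinuousMap.evalCLM ℝ (1 : unitInterval)).contDiff.comp_contDiffOn
      (hUs.mono Set.inter_subset_left)
  · intro y hy
    have := hU2 _ hy.1
    rw [hN0, add_zero] at this
    simp only [this, constPath_apply]
  · intro z hz v
    have hz0 := hz.1
    have hUd : HasFDerivAt U (fderiv ℝ U z) z :=
      ((hUs.contDiffAt (hΩ₀.mem_nhds hz0)).differentiableAt (by simp)).hasFDerivAt
    set W := fderiv ℝ U z (v, 0) with hW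
    have hΦ : fderiv ℝ (fun z => U z 1) z (v, 0) = W 1 := by
      have := (ContinuousMap.evalCLM (M := Y) ℝ (1 : unitInterval)).hasFDerivAt.comp z hUd
      have h' : fderiv ℝ (fun z => U z 1) z = _ := this.fderiv
      rw [h']; rfl
    have hGW : G' (z, U z) ((v, 0), W) = 0 := by
      have h1 : HasFDerivAt (fun z => G (z, U z)) _ z :=
        (hG (z, U z)).comp z ((hasFDerivAt_id z).prodMk hUd)
      have h2 : (fun z => G (z, U z)) =ᶠ[𝓝 z] fun _ => 0 := by
        filter_upwards [hΩ₀.mem_nhds hz0] with y hy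
        have := hU2 y hy
        simp only [G]
        rw [sub_sub, sub_eq_zero]
        exact this
      have h3 := (h1.congr_of_eventuallyEq h2.symm).unique (hasFDerivAt_const _ z)
      exact congrArg (fun L => L (v, 0)) h3
    -- `T` is the expected derivative of `U` in the direction `(v, 0)`, and `W` the actual one. Both
    -- solve the linearised equation, which has a single solution since the derivative of `H` is
    -- invertible on `e.source`. At `t = 1` this is the differential equation.
    let T : C(unitInterval, Y) :=
      ⟨fun t => (t : ℝ) • A ((t : ℝ) • z.1, U z t) v, by
        have := hA.continuous
        fun_prop⟩
    have hGT : G' (z, U z) ((v, 0), T) = 0 := by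
      have hT := linearised_rayIntegral hA f (fun _ => rfl) (hU2 z hz0) (v := v) (T := T)
        (fun _ => rfl) fun t => by
          refine hrI ?_ _ _
          have h1 := hz.2
          simp only [Set.mem_preimage, mem_ball_zero_iff] at h1
          rw [dist_zero_right]
          refine lt_of_le_of_lt (max_le ?_ ?_) h1
          · change ‖(t : ℝ) • z.1‖ ≤ _
            rw [norm_smul, Real.norm_of_nonneg t.2.1]
            exact (mul_le_of_le_one_left (norm_nonneg _) t.2.2).trans (norm_fst_le (z.1, U z))
          · exact ((U z).norm_coe_le_norm t).trans (norm_snd_le (z.1, U z))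
      simp only [G', ι]
      simpa [sub_eq_zero] using hT
    have hmem : (z, U z) ∈ e.source := by
      rw [← hU1 z hz0]; exact e.map_target hz0
    obtain ⟨g, hg⟩ := hinv _ hmem
    rw [(hH _).fderiv] at hg
    have hWT : W = T := by
      have h1 : g ((v, 0), W) = g ((v, 0), T) := by
        have h2 : ∀ p, g p = (p.1, G' (z, U z) p) := fun p => congrArg (fun L => L p) hg
        rw [h2, h2, hGW, hGT]
      exact congrArg Prod.snd (g.injective h1)
    rw [hΦ, hWT]
    simp [T]

end TotalDifferential

/-! ### Straightening integrable distributions -/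

section Straightening

/-- An integrable distribution given as a graph is straightened by a local diffeomorphism. -/
theorem exists_straightening_graph {X Y : Type} [NormedAddCommGroup X] [NormedSpace ℝ X]
    [CompleteSpace X] [NormedAddCommGroup Y] [NormedSpace ℝ Y] [CompleteSpace Y]
    {A : X × Y → X →L[ℝ] Y} (hA : ContDiff ℝ ∞ A)
    (hI : ∀ᶠ z in 𝓝 (0 : X × Y), ∀ v w, fderiv ℝ A z (v, A z v) w = fderiv ℝ A z (w, A z w) v) :
    ∃ e : OpenPartialHomeomorph (X × Y) (X × Y), (0 : X × Y) ∈ e.source ∧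
      ContDiffOn ℝ ∞ e e.source ∧ ContDiffOn ℝ ∞ e.symm e.target ∧
      ∀ z ∈ e.source, ∀ ζ, (fderiv ℝ e z ζ).2 = 0 ↔ ζ.2 = A z ζ.1 := by
  obtain ⟨Φ, Ω, hΩ, h0, hΦ, hΦ0, hΦA⟩ := exists_solution_totalDifferential hA hI
  have hd : ∀ z ∈ Ω, HasFDerivAt Φ (fderiv ℝ Φ z) z := fun z hz =>
    ((hΦ.contDiffAt (hΩ.mem_nhds hz)).differentiableAt (by simp)).hasFDerivAt
  -- The map `(x, y) ↦ (x, Φ (x, y))` sends horizontal directions `(v, 0)` to graph directions `(v,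
  -- A v)`, so its inverse is the straightening. It is invertible near `0` because `Φ (0, y) = y`.
  have hΨd : ∀ z ∈ Ω, HasFDerivAt (fun z : X × Y => (z.1, Φ z))
      ((ContinuousLinearMap.fst ℝ X Y).prod (fderiv ℝ Φ z)) z :=
    fun z hz => hasFDerivAt_fst.prodMk (hd z hz)
  have hy : ∀ w, fderiv ℝ Φ 0 (0, w) = w := by
    intro w
    have h1 : HasFDerivAt (fun y : Y => Φ (0, y)) ((fderiv ℝ Φ 0).comp
        (ContinuousLinearMap.inr ℝ X Y)) 0 :=
      HasFDerivAt.comp (0 : Y) (g := Φ) (hd 0 h0) (ContinuousLinearMap.inr ℝ X Y).hasFDerivAt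
    have h2 : (fun y : Y => Φ (0, y)) =ᶠ[𝓝 0] id := by
      have hc : Continuous fun y : Y => ((0 : X), y) := by fun_prop
      filter_upwards [hc.continuousAt.preimage_mem_nhds (hΩ.mem_nhds h0)] with y hy
      exact hΦ0 y hy
    have h3 := (h1.congr_of_eventuallyEq h2.symm).unique (hasFDerivAt_id 0)
    exact congrArg (fun L => L w) h3
  let f' : (X × Y) ≃L[ℝ] (X × Y) := ContinuousLinearEquiv.skewProd
    (ContinuousLinearEquiv.refl ℝ X) (ContinuousLinearEquiv.refl ℝ Y)
    ((fderiv ℝ Φ 0).comp (ContinuousLinearMap.inl ℝ X Y))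
  have hf' : (ContinuousLinearMap.fst ℝ X Y).prod (fderiv ℝ Φ 0) = (f' : X × Y →L[ℝ] X × Y) := by
    refine ContinuousLinearMap.ext fun p => Prod.ext rfl ?_
    change fderiv ℝ Φ 0 p = p.2 + fderiv ℝ Φ 0 (p.1, 0)
    conv_rhs => rw [← hy p.2]
    rw [← map_add]
    simp
  obtain ⟨e, he0, heΩ, hef, hes, hinv⟩ := exists_smooth_local_inverse hΩ
    (contDiffOn_fst.prodMk hΦ) h0 f' (hf' ▸ hΨd 0 h0)
  have hE0 : e 0 = 0 := by rw [hef]; exact Prod.ext rfl (hΦ0 0 h0)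
  have hec : ContDiffOn ℝ ∞ e e.source := by
    rw [hef]; exact (contDiffOn_fst.prodMk hΦ).mono heΩ
  refine ⟨e.symm, ?_, hes, hec, ?_⟩
  · have := e.map_source he0
    rwa [hE0] at this
  · intro z hz ζ
    have hp : e.symm z ∈ e.source := e.map_target hz
    have hpΩ := heΩ hp
    have hez : ((e.symm z).1, Φ (e.symm z)) = z := by
      have := e.right_inv hz
      rwa [hef] at this
    obtain ⟨g, hg⟩ := hinv _ hp
    rw [(hΨd _ hpΩ).fderiv] at hg
    have hgd : HasFDerivAt e (g : X × Y →L[ℝ] X × Y) (e.symm z) := by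
      rw [hg, hef]; exact hΨd _ hpΩ
    have hsd : HasFDerivAt e.symm (g.symm : X × Y →L[ℝ] X × Y) z := e.hasFDerivAt_symm hz hgd
    rw [hsd.fderiv]
    have hgv : ∀ v, g (v, 0) = (v, A z v) := by
      intro v
      have h1 : g (v, 0) = (v, fderiv ℝ Φ (e.symm z) (v, 0)) := congrArg (fun L => L (v, 0)) hg
      rw [h1, hΦA _ hpΩ, hez]
    constructor
    · intro h
      have h1 : g.symm ζ = ((g.symm ζ).1, 0) := Prod.ext rfl h
      have h2 : ζ = ((g.symm ζ).1, A z (g.symm ζ).1) := by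
        rw [← hgv, ← h1, g.apply_symm_apply]
      rw [h2]
    · intro h
      have h1 : ζ = g (ζ.1, 0) := by rw [hgv]; exact Prod.ext rfl h
      have h2 : g.symm ζ = (ζ.1, 0) := g.injective (by rw [g.apply_symm_apply, ← h1])
      change (g.symm ζ).2 = 0
      rw [h2]

/-- A smooth function on a neighbourhood of `a` agrees near `a` with a globally smooth one. -/
theorem exists_contDiff_eqOn_ball {V W : Type*} [NormedAddCommGroup V] [NormedSpace ℝ V]
    [FiniteDimensional ℝ V] [NormedAddCommGroup W] [NormedSpace ℝ W] {O : Set V} (hO : IsOpen O)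
    {a : V} (ha : a ∈ O) {f : V → W} (hf : ContDiffOn ℝ ∞ f O) :
    ∃ (f₁ : V → W) (ε : ℝ), ContDiff ℝ ∞ f₁ ∧ 0 < ε ∧ Metric.ball a ε ⊆ O ∧
      ∀ p ∈ Metric.ball a ε, f₁ p = f p := by
  obtain ⟨ε, hε, hball⟩ := Metric.isOpen_iff.1 hO a ha
  -- Equal to 1 up to radius `ε / 3` and supported within `ε / 2 < ε`, so `χ • f` extends by zero.
  let χ : ContDiffBump a := ⟨ε / 3, ε / 2, by positivity, by linarith⟩
  have htO : tsupport χ ⊆ O := by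
    rw [χ.tsupport_eq]
    exact (Metric.closedBall_subset_ball (by change ε / 2 < ε; linarith)).trans hball
  refine ⟨fun p => χ p • f p, ε / 3, contDiff_iff_contDiffAt.2 fun p => ?_, by positivity,
    (Metric.ball_subset_ball (by linarith)).trans hball, fun p hp => ?_⟩
  · by_cases hpO : p ∈ O
    · exact χ.contDiffAt.smul (hf.contDiffAt (hO.mem_nhds hpO))
    · refine (contDiffAt_const (c := 0)).congr_of_eventuallyEq ?_
      filter_upwards [(isClosed_tsupport χ).isOpen_compl.mem_nhds fun h => hpO (htO h)] with q hq
      simp only [image_eq_zero_of_notMem_tsupport hq, zero_smul]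
  · simp only
    rw [χ.one_of_mem_closedBall (Metric.ball_subset_closedBall hp), one_smul]

/-- A family of surjective linear maps `ℓ z : E → Y` whose kernels are closed under Lie brackets
is straightened by a local diffeomorphism. -/
theorem exists_straightening_ker {E Y : Type} [NormedAddCommGroup E] [NormedSpace ℝ E]
    [FiniteDimensional ℝ E] [NormedAddCommGroup Y] [NormedSpace ℝ Y] [FiniteDimensional ℝ Y]
    {U : Set E} (hU : IsOpen U) {ℓ : E → E →L[ℝ] Y} (hℓ : ContDiffOn ℝ ∞ ℓ U) {z₀ : E}
    (hz₀ : z₀ ∈ U) (hsurj : Function.Surjective (ℓ z₀))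
    (hI : ∀ z ∈ U, ∀ V W : E → E, DifferentiableAt ℝ V z → DifferentiableAt ℝ W z →
      (∀ᶠ y in 𝓝 z, ℓ y (V y) = 0) → (∀ᶠ y in 𝓝 z, ℓ y (W y) = 0) →
      ℓ z (VectorField.lieBracket ℝ V W z) = 0) :
    ∃ e : OpenPartialHomeomorph E ((ℓ z₀).ker × Y), z₀ ∈ e.source ∧ e.source ⊆ U ∧
      ContDiffOn ℝ ∞ e e.source ∧ ContDiffOn ℝ ∞ e.symm e.target ∧
      ∀ z ∈ e.source, ∀ ζ, (fderiv ℝ e z ζ).2 = 0 ↔ ℓ z ζ = 0 := by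
  obtain ⟨s₀, hs₀⟩ := (ℓ z₀ : E →ₗ[ℝ] Y).exists_rightInverse_of_surjective
    (LinearMap.range_eq_top.2 hsurj)
  let s : Y →L[ℝ] E := s₀.toContinuousLinearMap
  have hs : Function.RightInverse s (ℓ z₀) := fun y => congrArg (fun L => L y) hs₀
  have : CompleteSpace E := FiniteDimensional.complete ℝ E
  have : CompleteSpace Y := FiniteDimensional.complete ℝ Y
  have : CompleteSpace (ℓ z₀).ker := FiniteDimensional.complete ℝ _
  -- The right inverse `s` splits `E` as `ker (ℓ z₀) ⊕ Y`. Wherever `ℓ z ∘ s` is still invertible,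
  -- `ker (ℓ z)` is the graph of `-(ℓ z ∘ s)⁻¹ ∘ ℓ z` over `ker (ℓ z₀)`, which is `A₀`.
  let θ : ((ℓ z₀).ker × Y) ≃L[ℝ] E :=
    (ContinuousLinearEquiv.prodComm ℝ _ _).trans
      (ContinuousLinearEquiv.equivOfRightInverse (ℓ z₀) s hs).symm
  have hθ : ∀ p, θ p = p.1 + s p.2 := by
    intro p
    simp [θ, add_comm]
  let pt : (ℓ z₀).ker × Y → E := fun p => z₀ + θ p
  have hpt : ContDiff ℝ ∞ pt := contDiff_const.add θ.contDiff
  have hpt0 : pt 0 = z₀ := by simp [pt]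
  let R : (ℓ z₀).ker × Y → Y →L[ℝ] Y := fun p => (ℓ (pt p)).comp s
  let O : Set ((ℓ z₀).ker × Y) := pt ⁻¹' U ∩ R ⁻¹' Set.range ((↑) : (Y ≃L[ℝ] Y) → Y →L[ℝ] Y)
  have hptU : IsOpen (pt ⁻¹' U) := hU.preimage hpt.continuous
  have hℓpt : ContDiffOn ℝ ∞ (fun p => ℓ (pt p)) (pt ⁻¹' U) :=
    hℓ.comp hpt.contDiffOn fun p hp => hp
  have hR : ContDiffOn ℝ ∞ R (pt ⁻¹' U) := hℓpt.clm_comp contDiffOn_const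
  have hO : IsOpen O := hR.continuousOn.isOpen_inter_preimage hptU ContinuousLinearEquiv.isOpen
  have h0O : (0 : (ℓ z₀).ker × Y) ∈ O := by
    refine ⟨by simpa [hpt0] using hz₀, ContinuousLinearEquiv.refl ℝ Y, ?_⟩
    ext y
    simp only [R, hpt0]
    exact (hs y).symm
  let A₀ : (ℓ z₀).ker × Y → (ℓ z₀).ker →L[ℝ] Y := fun p =>
    -((R p).inverse.comp ((ℓ (pt p)).comp (ℓ z₀).ker.subtypeL))
  have hA₀ : ContDiffOn ℝ ∞ A₀ O := by
    intro p hp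
    obtain ⟨g, hg⟩ := hp.2
    have h1 : ContDiffAt ℝ ∞ (fun p => (R p).inverse) p := by
      have h2 : ContDiffAt ℝ ∞ ContinuousLinearMap.inverse (R p) := hg ▸ contDiffAt_map_inverse g
      exact h2.comp p (hR.contDiffAt (hptU.mem_nhds hp.1))
    exact ((h1.clm_comp ((hℓpt.contDiffAt (hptU.mem_nhds hp.1)).clm_comp
      contDiffAt_const)).neg).contDiffWithinAt
  have hker : ∀ p ∈ O, ∀ ζ, ℓ (pt p) (θ ζ) = 0 ↔ ζ.2 = A₀ p ζ.1 := by
    intro p hp ζ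
    obtain ⟨g, hg⟩ := hp.2
    have h1 : ℓ (pt p) (θ ζ) = ℓ (pt p) ζ.1 + g ζ.2 := by
      rw [hθ, map_add]
      congr 1
      exact (congrArg (fun L => L ζ.2) hg).symm
    have h2 : A₀ p ζ.1 = - g.symm (ℓ (pt p) ζ.1) := by
      simp only [A₀, ← hg, ContinuousLinearMap.inverse_equiv]
      rfl
    rw [h1, h2]
    constructor
    · intro h
      rw [← map_neg, ← eq_neg_of_add_eq_zero_right h, g.symm_apply_apply]
    · intro h
      rw [h]; simp
  -- The straightening of graphs expects `A` smooth on the whole space, hence the cut-off.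
  obtain ⟨A, ε, hA, hε, hBO, hAB⟩ := exists_contDiff_eqOn_ball hO h0O hA₀
  let B := Metric.ball (0 : (ℓ z₀).ker × Y) ε
  have hIA : ∀ p ∈ B, ∀ v w, fderiv ℝ A p (v, A p v) w = fderiv ℝ A p (w, A p w) v := by
    intro p hp v w
    let inv : E → (ℓ z₀).ker × Y := fun z => θ.symm (z - z₀)
    have hinv : inv (pt p) = p := by simp [inv, pt]
    have hptinv : ∀ z, pt (inv z) = z := fun z => by simp [inv, pt]
    have hinvc : Continuous inv := by fun_prop
    -- Lifts to the kernel of the constant fields `v`. Their bracket has no component along `ker (ℓ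
    -- z₀)`, so it lies in the graph only if its `Y` component, the integrability defect, is zero.
    let V : (ℓ z₀).ker → E → E := fun v z => θ (v, A (inv z) v)
    have hV : ∀ v, HasFDerivAt (V v) ((θ : (ℓ z₀).ker × Y →L[ℝ] E).comp ((ContinuousLinearMap.inr ℝ (ℓ z₀).ker Y).comp
        (((fderiv ℝ A p).flip v).comp (θ.symm : E →L[ℝ] (ℓ z₀).ker × Y)))) (pt p) := by
      intro v
      have h1 : HasFDerivAt inv (θ.symm : E →L[ℝ] (ℓ z₀).ker × Y) (pt p) :=
        HasFDerivAt.comp (pt p) (g := θ.symm) θ.symm.hasFDerivAt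
          ((hasFDerivAt_id (pt p)).sub_const z₀)
      have h2 : HasFDerivAt A (fderiv ℝ A p) (inv (pt p)) := by
        rw [hinv]; exact (hA.differentiable (by simp) p).hasFDerivAt
      have h3 : HasFDerivAt (fun z => A (inv z) v) (((fderiv ℝ A p).flip v).comp
          (θ.symm : E →L[ℝ] (ℓ z₀).ker × Y)) (pt p) := by
        have := (HasFDerivAt.comp (pt p) (g := A) (f := inv) h2 h1).clm_apply
          (hasFDerivAt_const v (pt p))
        refine this.congr_fderiv ?_
        ext z; simp
      have h4 := (hasFDerivAt_const v (pt p)).prodMk h3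
      refine (HasFDerivAt.comp (pt p) (g := θ) θ.hasFDerivAt h4).congr_fderiv ?_
      ext z; simp
    have hVp : ∀ v, V v (pt p) = θ (v, A p v) := fun v => by simp only [V, hinv]
    have hVk : ∀ v, ∀ᶠ y in 𝓝 (pt p), ℓ y (V v y) = 0 := by
      intro v
      have hB : inv ⁻¹' B ∈ 𝓝 (pt p) := by
        refine hinvc.continuousAt.preimage_mem_nhds ?_
        rw [hinv]; exact Metric.isOpen_ball.mem_nhds hp
      filter_upwards [hB] with y hy
      have := (hker (inv y) (hBO hy) (v, A (inv y) v)).2 (by rw [hAB _ hy])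
      rwa [hptinv] at this
    have hbr := hI (pt p) (hBO hp).1 (V v) (V w) (hV v).differentiableAt (hV w).differentiableAt
      (hVk v) (hVk w)
    have hbr' : VectorField.lieBracket ℝ (V v) (V w) (pt p) =
        θ (0, fderiv ℝ A p (v, A p v) w - fderiv ℝ A p (w, A p w) v) := by
      rw [VectorField.lieBracket, (hV v).fderiv, (hV w).fderiv, hVp, hVp]
      simp [← map_sub]
    rw [hbr', hker p (hBO hp), map_zero, sub_eq_zero] at hbr
    exact hbr
  obtain ⟨e, he0, hes, hes', hek⟩ := exists_straightening_graph hA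
    (Filter.eventually_of_mem (Metric.ball_mem_nhds 0 (by positivity)) hIA)
  let T : E ≃ₜ (ℓ z₀).ker × Y := (Homeomorph.subRight z₀).trans θ.symm.toHomeomorph
  have hT : ∀ z, T z = θ.symm (z - z₀) := fun z => rfl
  have hTs : ∀ p, T.symm p = pt p := fun p => by
    change θ p + z₀ = z₀ + θ p
    rw [add_comm]
  have hTd : ∀ z, HasFDerivAt T (θ.symm : E →L[ℝ] (ℓ z₀).ker × Y) z := fun z =>
    HasFDerivAt.comp z (g := θ.symm) θ.symm.hasFDerivAt ((hasFDerivAt_id z).sub_const z₀)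
  have hTc : ContDiff ℝ ∞ T := θ.symm.contDiff.comp (contDiff_id.sub contDiff_const)
  let eB := e.restrOpen B Metric.isOpen_ball
  have heBs : eB.source = e.source ∩ B := rfl
  refine ⟨T.toOpenPartialHomeomorph.trans eB, ?_, ?_, ?_, ?_, ?_⟩
  · simp only [OpenPartialHomeomorph.trans_source, heBs]
    simp [hT, he0, B, hε]
  · intro z hz
    have h1 : T z ∈ B := by
      simp only [OpenPartialHomeomorph.trans_source, heBs] at hz
      exact hz.2.2
    have h2 := (hBO h1).1
    rwa [Set.mem_preimage, ← hTs, T.symm_apply_apply] at h2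
  · refine hes.comp hTc.contDiffOn fun z hz => ?_
    simp only [OpenPartialHomeomorph.trans_source, heBs] at hz
    exact hz.2.1
  · have h1 : ContDiffOn ℝ ∞ (fun p => pt (e.symm p)) e.target := hpt.comp_contDiffOn hes'
    refine (h1.mono fun p hp => ?_).congr fun p hp => ?_
    · simp only [OpenPartialHomeomorph.trans_target] at hp
      exact hp.1.1
    · exact hTs _
  · intro z hz ζ
    simp only [OpenPartialHomeomorph.trans_source, heBs] at hz
    have hzs : T z ∈ e.source := hz.2.1
    have hzB : T z ∈ B := hz.2.2
    have h1 : HasFDerivAt (e ∘ T) ((fderiv ℝ e (T z)).comp (θ.symm : E →L[ℝ] (ℓ z₀).ker × Y)) z := by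
      refine HasFDerivAt.comp z ?_ (hTd z)
      exact ((hes.contDiffAt (e.open_source.mem_nhds hzs)).differentiableAt (by simp)).hasFDerivAt
    have h2 : fderiv ℝ (T.toOpenPartialHomeomorph.trans eB) z = _ := h1.fderiv
    rw [h2]
    change (fderiv ℝ e (T z) (θ.symm ζ)).2 = 0 ↔ _
    rw [hek _ hzs, hAB _ hzB, ← hker _ (hBO hzB), θ.apply_symm_apply, ← hTs, T.symm_apply_apply]

end Straightening

/-! ### Simple 2-forms on a vector space -/

section SimpleForms

lemma covectorWedge_apply {V : Type*} [AddCommGroup V] [Module ℝ V] [TopologicalSpace V]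
    (α β : V →L[ℝ] ℝ) (v : Fin 2 → V) :
    covectorWedge α β v = α (v 0) * β (v 1) - α (v 1) * β (v 0) := rfl

lemma exists_covectorWedge_ne_zero {V : Type*} [AddCommGroup V] [Module ℝ V] [TopologicalSpace V]
    {α β : V →L[ℝ] ℝ} (h : covectorWedge α β ≠ 0) : ∃ v w, α v * β w - α w * β v ≠ 0 := by
  by_contra! H
  exact h (ContinuousAlternatingMap.ext fun v => H (v 0) (v 1))

/-- The kernel of `α ∧ β ≠ 0` is `ker α ∩ ker β`. -/
lemma eq_zero_of_covectorWedge_apply_eq_zero {V : Type*} [AddCommGroup V] [Module ℝ V]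
    [TopologicalSpace V] {α β : V →L[ℝ] ℝ} (h : covectorWedge α β ≠ 0) {x : V}
    (hx : ∀ c, α x * β c - α c * β x = 0) : α x = 0 ∧ β x = 0 := by
  obtain ⟨v, w, hvw⟩ := exists_covectorWedge_ne_zero h
  have h1 := hx v
  have h2 := hx w
  constructor
  · have : α x * (α v * β w - α w * β v) = 0 := by linear_combination α v * h2 - α w * h1
    exact (mul_eq_zero.1 this).resolve_right hvw
  · have : β x * (α v * β w - α w * β v) = 0 := by linear_combination β v * h2 - β w * h1
    exact (mul_eq_zero.1 this).resolve_right hvw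

/-- Cramer's rule, with the value of the wedge on a suitable pair as determinant. -/
lemma surjective_of_covectorWedge_ne_zero {V : Type*} [AddCommGroup V] [Module ℝ V]
    [TopologicalSpace V] {α β : V →L[ℝ] ℝ} (h : covectorWedge α β ≠ 0) :
    Function.Surjective (α.prod β) := by
  obtain ⟨v, w, hvw⟩ := exists_covectorWedge_ne_zero h
  rintro ⟨p, q⟩
  refine ⟨((p * β w - q * α w) / (α v * β w - α w * β v)) • v +
    ((q * α v - p * β v) / (α v * β w - α w * β v)) • w, ?_⟩
  refine Prod.ext ?_ ?_
  · simp only [ContinuousLinearMap.prod_apply, map_add, map_smul, Prod.fst_add,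
      Prod.smul_fst, smul_eq_mul]
    rw [div_mul_eq_mul_div, div_mul_eq_mul_div, ← add_div, div_eq_iff hvw]
    ring
  · simp only [ContinuousLinearMap.prod_apply, map_add, map_smul, Prod.snd_add,
      Prod.smul_snd, smul_eq_mul]
    rw [div_mul_eq_mul_div, div_mul_eq_mul_div, ← add_div, div_eq_iff hvw]
    ring

variable {E : Type*} [NormedAddCommGroup E] [NormedSpace ℝ E]

/-- The wedge product of covectors as a continuous bilinear map. -/
def covectorWedgeL : (E →L[ℝ] ℝ) →L[ℝ] (E →L[ℝ] ℝ) →L[ℝ] E [⋀^Fin 2]→L[ℝ] ℝ :=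
  LinearMap.mkContinuous₂
    (LinearMap.mk₂ ℝ covectorWedge
      (fun a₁ a₂ b => by ext v; simp [covectorWedge_apply]; ring)
      (fun c a b => by ext v; simp [covectorWedge_apply]; ring)
      (fun a b₁ b₂ => by ext v; simp [covectorWedge_apply]; ring)
      (fun c a b => by ext v; simp [covectorWedge_apply]; ring)) 2 fun a b => by
    refine ContinuousAlternatingMap.opNorm_le_bound _ (by positivity) fun v => ?_
    rw [Fin.prod_univ_two]
    change ‖a (v 0) * b (v 1) - a (v 1) * b (v 0)‖ ≤ _
    refine (norm_sub_le _ _).trans ?_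
    rw [norm_mul, norm_mul]
    have h1 := mul_le_mul (a.le_opNorm (v 0)) (b.le_opNorm (v 1)) (norm_nonneg _) (by positivity)
    have h2 := mul_le_mul (a.le_opNorm (v 1)) (b.le_opNorm (v 0)) (norm_nonneg _) (by positivity)
    linarith

lemma differentiableAt_covectorWedge {a b : E → E →L[ℝ] ℝ} {z : E} (ha : DifferentiableAt ℝ a z)
    (hb : DifferentiableAt ℝ b z) : DifferentiableAt ℝ (fun y => covectorWedge (a y) (b y)) z :=
  DifferentiableAt.clm_apply (c := fun y => covectorWedgeL (a y))
    (DifferentiableAt.comp z (ContinuousLinearMap.differentiableAt (E := E →L[ℝ] ℝ)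
      (F := (E →L[ℝ] ℝ) →L[ℝ] E [⋀^Fin 2]→L[ℝ] ℝ) covectorWedgeL) ha) hb

/-- The Lie bracket of two sections of the kernel of a closed simple 2-form is in the kernel. -/
theorem lieBracket_mem_ker_of_extDeriv_eq_zero {a b : E → E →L[ℝ] ℝ} {z : E}
    (ha : DifferentiableAt ℝ a z) (hb : DifferentiableAt ℝ b z)
    (hd : extDeriv (fun y => covectorWedge (a y) (b y)) z = 0)
    (h0 : covectorWedge (a z) (b z) ≠ 0) {V W : E → E} (hV : DifferentiableAt ℝ V z)
    (hW : DifferentiableAt ℝ W z) (hVk : ∀ᶠ y in 𝓝 z, a y (V y) = 0 ∧ b y (V y) = 0)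
    (hWk : ∀ᶠ y in 𝓝 z, a y (W y) = 0 ∧ b y (W y) = 0) :
    a z (VectorField.lieBracket ℝ V W z) = 0 ∧ b z (VectorField.lieBracket ℝ V W z) = 0 := by
  refine eq_zero_of_covectorWedge_apply_eq_zero h0 fun c => ?_
  -- With `c` constant, each of the three derivative terms differentiates the form on a pair
  -- containing `V` or `W`. The brackets `[V, c]` and `[W, c]` are paired with `W` and `V`. Only the
  -- form on `([V, W], c)` remains.
  have key := extDeriv_apply_vectorField 
    (V := ![V, W, fun _ => c]) (differentiableAt_covectorWedge ha hb) (x := z) (by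
      intro i
      fin_cases i
      · exact hV
      · exact hW
      · exact differentiableAt_const c)
  have hV0 := hVk.self_of_nhds
  have hW0 := hWk.self_of_nhds
  have e0 : fderiv ℝ (fun y => covectorWedge (a y) (b y)
      ((0 : Fin 3).removeNth fun i => (![V, W, fun _ => c] : Fin 3 → E → E) i y)) z = 0 := by
    have : (fun y => covectorWedge (a y) (b y)
      ((0 : Fin 3).removeNth fun i => (![V, W, fun _ => c] : Fin 3 → E → E) i y)) =ᶠ[𝓝 z]
        fun _ => 0 := by
      filter_upwards [hWk] with y hy
      change a y (W y) * b y c - a y c * b y (W y) = 0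
      simp [hy.1, hy.2]
    rw [this.fderiv_eq]; simp
  have e1 : fderiv ℝ (fun y => covectorWedge (a y) (b y)
      ((1 : Fin 3).removeNth fun i => (![V, W, fun _ => c] : Fin 3 → E → E) i y)) z = 0 := by
    have : (fun y => covectorWedge (a y) (b y)
      ((1 : Fin 3).removeNth fun i => (![V, W, fun _ => c] : Fin 3 → E → E) i y)) =ᶠ[𝓝 z]
        fun _ => 0 := by
      filter_upwards [hVk] with y hy
      change a y (V y) * b y c - a y c * b y (V y) = 0
      simp [hy.1, hy.2]
    rw [this.fderiv_eq]; simp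
  have e2 : fderiv ℝ (fun y => covectorWedge (a y) (b y)
      ((2 : Fin 3).removeNth fun i => (![V, W, fun _ => c] : Fin 3 → E → E) i y)) z = 0 := by
    have : (fun y => covectorWedge (a y) (b y)
      ((2 : Fin 3).removeNth fun i => (![V, W, fun _ => c] : Fin 3 → E → E) i y)) =ᶠ[𝓝 z]
        fun _ => 0 := by
      filter_upwards [hVk] with y hy
      change a y (V y) * b y (W y) - a y (W y) * b y (V y) = 0
      simp [hy.1, hy.2]
    rw [this.fderiv_eq]; simp
  rw [hd] at key
  -- The pairs `i ≤ j` in `Fin 2` encode the three pairs `i.castSucc < j.succ` in `Fin 3`.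
  have hsum : ∀ f : Fin 2 → Fin 2 → ℝ, (∑ i : Fin 2, ∑ j ≥ i, f i j) = f 0 0 + f 0 1 + f 1 1 := by
    intro f
    have h0 : Finset.Ici (0 : Fin 2) = {0, 1} := by decide
    have h1 : Finset.Ici (1 : Fin 2) = {1} := by decide
    rw [Fin.sum_univ_two, h0, h1, Finset.sum_pair (by decide), Finset.sum_singleton]
  rw [hsum, Fin.sum_univ_three] at key
  rw [e0, e1, e2] at key
  set B := VectorField.lieBracket ℝ V W z
  have t0 : (covectorWedge (a z) (b z)) (Matrix.vecCons
      (VectorField.lieBracket ℝ ((![V, W, fun _ => c] : Fin 3 → E → E) (0 : Fin 2).castSucc)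
        ((![V, W, fun _ => c] : Fin 3 → E → E) (0 : Fin 2).succ) z)
      ((0 : Fin 2).removeNth ((0 : Fin 2).castSucc.removeNth
        fun i => (![V, W, fun _ => c] : Fin 3 → E → E) i z))) = a z B * b z c - a z c * b z B := rfl
  have t1 : (covectorWedge (a z) (b z)) (Matrix.vecCons
      (VectorField.lieBracket ℝ ((![V, W, fun _ => c] : Fin 3 → E → E) (0 : Fin 2).castSucc)
        ((![V, W, fun _ => c] : Fin 3 → E → E) (1 : Fin 2).succ) z)
      ((1 : Fin 2).removeNth ((0 : Fin 2).castSucc.removeNth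
        fun i => (![V, W, fun _ => c] : Fin 3 → E → E) i z))) = 0 := by
    change a z _ * b z (W z) - a z (W z) * b z _ = 0
    simp [hW0.1, hW0.2]
  have t2 : (covectorWedge (a z) (b z)) (Matrix.vecCons
      (VectorField.lieBracket ℝ ((![V, W, fun _ => c] : Fin 3 → E → E) (1 : Fin 2).castSucc)
        ((![V, W, fun _ => c] : Fin 3 → E → E) (1 : Fin 2).succ) z)
      ((1 : Fin 2).removeNth ((1 : Fin 2).castSucc.removeNth
        fun i => (![V, W, fun _ => c] : Fin 3 → E → E) i z))) = 0 := by
    change a z _ * b z (V z) - a z (V z) * b z _ = 0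
    simp [hV0.1, hV0.2]
  rw [t0, t1, t2] at key
  simp at key
  linarith

end SimpleForms

/-- A closed nowhere-vanishing simple 2-form on an open set is straightened: in suitable
coordinates its kernel is given by `dx² = dx³ = 0`. -/
theorem exists_straightening_of_closed
    {a b : EuclideanSpace ℝ (Fin 4) → EuclideanSpace ℝ (Fin 4) →L[ℝ] ℝ}
    {U : Set (EuclideanSpace ℝ (Fin 4))} (hU : IsOpen U) (ha : ContDiffOn ℝ ∞ a U)
    (hb : ContDiffOn ℝ ∞ b U) (h0 : ∀ z ∈ U, covectorWedge (a z) (b z) ≠ 0)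
    (hd : ∀ z ∈ U, extDeriv (fun y => covectorWedge (a y) (b y)) z = 0)
    {z₀ : EuclideanSpace ℝ (Fin 4)} (hz₀ : z₀ ∈ U) :
    ∃ e : OpenPartialHomeomorph (EuclideanSpace ℝ (Fin 4)) (EuclideanSpace ℝ (Fin 4)),
      z₀ ∈ e.source ∧ e.source ⊆ U ∧ ContDiffOn ℝ ∞ e e.source ∧ ContDiffOn ℝ ∞ e.symm e.target ∧
      ∀ z ∈ e.source, ∀ ζ, (a z ζ = 0 ∧ b z ζ = 0) ↔
        ∀ i : Fin 4, 2 ≤ (i : ℕ) → fderiv ℝ e z ζ i = 0 := by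
  let ℓ : EuclideanSpace ℝ (Fin 4) → EuclideanSpace ℝ (Fin 4) →L[ℝ] ℝ × ℝ :=
    fun z => (a z).prod (b z)
  have hℓ : ContDiffOn ℝ ∞ ℓ U := by
    have h2 : ℓ = fun z => (ContinuousLinearMap.inl ℝ ℝ ℝ).comp (a z) +
        (ContinuousLinearMap.inr ℝ ℝ ℝ).comp (b z) := by
      ext z v <;> simp [ℓ]
    rw [h2]
    exact (contDiffOn_const.clm_comp ha).add (contDiffOn_const.clm_comp hb)
  have hℓ0 : ∀ z ζ, ℓ z ζ = 0 ↔ a z ζ = 0 ∧ b z ζ = 0 := fun z ζ => Prod.mk_eq_zero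
  have hsurj : Function.Surjective (ℓ z₀) := surjective_of_covectorWedge_ne_zero (h0 z₀ hz₀)
  obtain ⟨e, he0, heU, hes, hes', hek⟩ := exists_straightening_ker hU hℓ hz₀ hsurj (by
    intro z hz V W hV hW hVk hWk
    rw [hℓ0]
    simp only [hℓ0] at hVk hWk
    exact lieBracket_mem_ker_of_extDeriv_eq_zero
      ((ha.contDiffAt (hU.mem_nhds hz)).differentiableAt (by simp))
      ((hb.contDiffAt (hU.mem_nhds hz)).differentiableAt (by simp)) (hd z hz) (h0 z hz)
      hV hW hVk hWk)
  have hrank : Module.finrank ℝ (ℓ z₀).ker = 2 := by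
    have h1 := (ℓ z₀ : EuclideanSpace ℝ (Fin 4) →ₗ[ℝ] ℝ × ℝ).finrank_range_add_finrank_ker
    have h2 : Module.finrank ℝ
        (LinearMap.range (ℓ z₀ : EuclideanSpace ℝ (Fin 4) →ₗ[ℝ] ℝ × ℝ)) = 2 := by
      rw [LinearMap.range_eq_top.2 hsurj, finrank_top]; simp
    rw [h2] at h1
    simp only [finrank_euclideanSpace, Fintype.card_fin] at h1
    exact Nat.add_left_cancel (n := 2) h1
  let k : (ℓ z₀).ker ≃ₗ[ℝ] (Fin 2 → ℝ) :=
    LinearEquiv.ofFinrankEq _ _ (by rw [hrank]; simp)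
  -- The transverse factor is placed in coordinates 2 and 3, as the convention `k ≤ i` for plaques
  -- requires.
  let τ₀ : ((ℓ z₀).ker × (ℝ × ℝ)) ≃ₗ[ℝ] EuclideanSpace ℝ (Fin 4) :=
    { toFun := fun p => !₂[k p.1 0, k p.1 1, p.2.1, p.2.2]
      map_add' := fun p q => by ext i; fin_cases i <;> simp
      map_smul' := fun c p => by ext i; fin_cases i <;> simp
      invFun := fun x => (k.symm ![x 0, x 1], (x 2, x 3))
      left_inv := fun p => by
        refine Prod.ext ?_ rfl
        refine k.injective ?_
        simp only [LinearEquiv.apply_symm_apply]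
        ext i; fin_cases i <;> rfl
      right_inv := fun x => by ext i; fin_cases i <;> simp }
  let τ : ((ℓ z₀).ker × (ℝ × ℝ)) ≃L[ℝ] EuclideanSpace ℝ (Fin 4) := τ₀.toContinuousLinearEquiv
  have hτ : ∀ p, (∀ i : Fin 4, 2 ≤ (i : ℕ) → τ p i = 0) ↔ p.2 = 0 := by
    intro p
    have h2 : τ p 2 = p.2.1 := rfl
    have h3 : τ p 3 = p.2.2 := rfl
    constructor
    · intro h
      exact Prod.ext (h2 ▸ h 2 le_rfl) (h3 ▸ h 3 (by decide))
    · intro h i hi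
      fin_cases i
      · exact absurd hi (by decide)
      · exact absurd hi (by decide)
      · exact h2.trans (by rw [h]; rfl)
      · exact h3.trans (by rw [h]; rfl)
  refine ⟨e.transHomeomorph τ.toHomeomorph, he0, heU, τ.contDiff.comp_contDiffOn hes, ?_, ?_⟩
  · exact hes'.comp (t := e.target) τ.symm.contDiff.contDiffOn fun p hp => hp
  · intro z hz ζ
    have h1 : HasFDerivAt (e.transHomeomorph τ.toHomeomorph)
        ((τ : _ →L[ℝ] EuclideanSpace ℝ (Fin 4)).comp (fderiv ℝ e z)) z :=
      HasFDerivAt.comp z (g := τ) τ.hasFDerivAt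
        ((hes.contDiffAt (e.open_source.mem_nhds hz)).differentiableAt (by simp)).hasFDerivAt
    rw [h1.fderiv, ← hℓ0, ← hek z hz, ← hτ]
    rfl

/-! ### Flat charts -/

section FlatCharts

variable {m k : ℕ} {M : Type*} [TopologicalSpace M] [ChartedSpace (EuclideanSpace ℝ (Fin m)) M]

/-- A smooth chart in which the distribution `D` is given by `dx^i = 0`, `k ≤ i`. -/
def IsTangentChart (k : ℕ) (D : TangentField m M)
    (φ : OpenPartialHomeomorph M (EuclideanSpace ℝ (Fin m))) : Prop :=
  φ ∈ IsManifold.maximalAtlas (𝓡 m) ∞ M ∧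
  ∀ q ∈ φ.source, ∀ v : TangentSpace (𝓡 m) q, v ∈ D q ↔
    ∀ i : Fin m, k ≤ (i : ℕ) →
      mfderiv (𝓡 m) 𝓘(ℝ, ℝ) (fun x : M => φ x i) q v = (0 : ℝ)

lemma mdifferentiable_of_mem_maximalAtlas
    {φ : OpenPartialHomeomorph M (EuclideanSpace ℝ (Fin m))}
    (hφ : φ ∈ IsManifold.maximalAtlas (𝓡 m) ∞ M) : φ.MDifferentiable (𝓡 m) (𝓡 m) :=
  ⟨(contMDiffOn_of_mem_maximalAtlas hφ).mdifferentiableOn (by simp),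
    (contMDiffOn_symm_of_mem_maximalAtlas hφ).mdifferentiableOn (by simp)⟩

lemma hasMFDerivAt_coord {φ : OpenPartialHomeomorph M (EuclideanSpace ℝ (Fin m))}
    (hφ : φ ∈ IsManifold.maximalAtlas (𝓡 m) ∞ M) {q : M} (hq : q ∈ φ.source) (i : Fin m) :
    HasMFDerivAt (𝓡 m) 𝓘(ℝ, ℝ) (fun x : M => φ x i) q
      ((EuclideanSpace.proj i : EuclideanSpace ℝ (Fin m) →L[ℝ] ℝ).comp
        (mfderiv (𝓡 m) (𝓡 m) φ q)) := by
  have h1 := ((mdifferentiable_of_mem_maximalAtlas hφ).mdifferentiableAt hq).hasMFDerivAt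
  exact HasMFDerivAt.comp q (EuclideanSpace.proj i :
    EuclideanSpace ℝ (Fin m) →L[ℝ] ℝ).hasMFDerivAt h1

lemma mfderiv_coord {φ : OpenPartialHomeomorph M (EuclideanSpace ℝ (Fin m))}
    (hφ : φ ∈ IsManifold.maximalAtlas (𝓡 m) ∞ M) {q : M} (hq : q ∈ φ.source) (i : Fin m)
    (v : TangentSpace (𝓡 m) q) :
    mfderiv (𝓡 m) 𝓘(ℝ, ℝ) (fun x : M => φ x i) q v =
      (show EuclideanSpace ℝ (Fin m) from mfderiv (𝓡 m) (𝓡 m) φ q v) i := by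
  rw [(hasMFDerivAt_coord hφ hq i).mfderiv]; rfl

/-- The derivative of a function expressed in a chart. -/
lemma hasFDerivAt_comp_symm {φ : OpenPartialHomeomorph M (EuclideanSpace ℝ (Fin m))}
    (hφ : φ ∈ IsManifold.maximalAtlas (𝓡 m) ∞ M) {y : EuclideanSpace ℝ (Fin m)}
    (hy : y ∈ φ.target) {f : M → ℝ} (hf : MDifferentiableAt (𝓡 m) 𝓘(ℝ, ℝ) f (φ.symm y)) :
    HasFDerivAt (f ∘ φ.symm) ((mfderiv (𝓡 m) 𝓘(ℝ, ℝ) f (φ.symm y)).comp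
      (mfderiv 𝓘(ℝ, EuclideanSpace ℝ (Fin m)) (𝓡 m) φ.symm y)) y := by
  have h1 := ((mdifferentiable_of_mem_maximalAtlas hφ).mdifferentiableAt_symm hy).hasMFDerivAt
  exact (HasMFDerivAt.comp y hf.hasMFDerivAt h1).hasFDerivAt

lemma mfderiv_mfderiv_symm {φ : OpenPartialHomeomorph M (EuclideanSpace ℝ (Fin m))}
    (hφ : φ ∈ IsManifold.maximalAtlas (𝓡 m) ∞ M) {y : EuclideanSpace ℝ (Fin m)}
    (hy : y ∈ φ.target) (d : EuclideanSpace ℝ (Fin m)) :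
    mfderiv (𝓡 m) (𝓡 m) φ (φ.symm y)
      (mfderiv 𝓘(ℝ, EuclideanSpace ℝ (Fin m)) (𝓡 m) φ.symm y d) = d := by
  have := (mdifferentiable_of_mem_maximalAtlas hφ).comp_symm_deriv hy
  exact congrArg (fun L : EuclideanSpace ℝ (Fin m) →L[ℝ] EuclideanSpace ℝ (Fin m) => L d) this

lemma mfderiv_symm_mfderiv {φ : OpenPartialHomeomorph M (EuclideanSpace ℝ (Fin m))}
    (hφ : φ ∈ IsManifold.maximalAtlas (𝓡 m) ∞ M) {q : M}
    (hq : q ∈ φ.source) (v : TangentSpace (𝓡 m) q) :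
    mfderiv 𝓘(ℝ, EuclideanSpace ℝ (Fin m)) (𝓡 m) φ.symm (φ q)
      (mfderiv (𝓡 m) (𝓡 m) φ q v) = v := by
  have := (mdifferentiable_of_mem_maximalAtlas hφ).symm_comp_deriv hq
  exact congrArg (fun L : EuclideanSpace ℝ (Fin m) →L[ℝ] EuclideanSpace ℝ (Fin m) => L v) this

/-- In a tangent chart the distribution consists of the vectors with vanishing transverse
components. -/
lemma IsTangentChart.mfderiv_symm_mem_iff {D : TangentField m M}
    {φ : OpenPartialHomeomorph M (EuclideanSpace ℝ (Fin m))} (hφ : IsTangentChart k D φ)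
    {y : EuclideanSpace ℝ (Fin m)} (hy : y ∈ φ.target) (d : EuclideanSpace ℝ (Fin m)) :
    mfderiv 𝓘(ℝ, EuclideanSpace ℝ (Fin m)) (𝓡 m) φ.symm y d ∈ D (φ.symm y) ↔
      ∀ i : Fin m, k ≤ (i : ℕ) → d i = 0 := by
  rw [hφ.2 _ (φ.map_target hy)]
  refine forall_congr' fun i => forall_congr' fun _ => ?_
  rw [mfderiv_coord hφ.1 (φ.map_target hy), mfderiv_mfderiv_symm hφ.1 hy]
  rfl

/-- The transverse coordinates of a tangent chart are locally constant along the plaques of any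
other tangent chart. -/
theorem IsTangentChart.eventually_transverse_eq {D : TangentField m M}
    {φ ψ : OpenPartialHomeomorph M (EuclideanSpace ℝ (Fin m))} (hφ : IsTangentChart k D φ)
    (hψ : IsTangentChart k D ψ) {p : M} (hpφ : p ∈ φ.source) (hpψ : p ∈ ψ.source) :
    ∀ᶠ q in 𝓝 p, q ∈ φ.source ∧ q ∈ ψ.source ∧
      ((∀ i : Fin m, k ≤ (i : ℕ) → φ q i = φ p i) →
        ∀ i : Fin m, k ≤ (i : ℕ) → ψ q i = ψ p i) := by
  have hO : IsOpen (φ.target ∩ φ.symm ⁻¹' ψ.source) :=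
    φ.isOpen_inter_preimage_symm ψ.open_source
  obtain ⟨r, hr, hball⟩ := Metric.isOpen_iff.1 hO (φ p)
    ⟨φ.map_source hpφ, by simpa [φ.left_inv hpφ] using hpψ⟩
  filter_upwards [φ.open_source.mem_nhds hpφ, ψ.open_source.mem_nhds hpψ,
    (φ.continuousAt hpφ).preimage_mem_nhds (Metric.ball_mem_nhds _ hr)] with q hqφ hqψ hqr
  refine ⟨hqφ, hqψ, fun h i hi => ?_⟩
  -- In the coordinates of `φ` the segment from `p` to `q` is tangent to `D`, so each transverse
  -- coordinate of `ψ` has zero derivative along it. The ball keeps the segment inside both charts.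
  set d := φ q - φ p with hd
  have hdi : ∀ i : Fin m, k ≤ (i : ℕ) → d i = 0 := by
    intro i hi
    rw [hd, PiLp.sub_apply, h i hi, sub_self]
  have hmem : ∀ s ∈ Set.Icc (0 : ℝ) 1, φ p + s • d ∈ φ.target ∩ φ.symm ⁻¹' ψ.source := by
    intro s hs
    refine hball ?_
    rw [mem_ball_iff_norm, add_sub_cancel_left, norm_smul, Real.norm_of_nonneg hs.1]
    rw [Set.mem_preimage, mem_ball_iff_norm] at hqr
    exact (mul_le_of_le_one_left (norm_nonneg _) hs.2).trans_lt hqr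
  have hder : ∀ s ∈ Set.Icc (0 : ℝ) 1,
      HasDerivAt (fun s : ℝ => ψ (φ.symm (φ p + s • d)) i) 0 s := by
    intro s hs
    have hy := hmem s hs
    have h1 : HasDerivAt (fun s : ℝ => φ p + s • d) d s := by
      simpa using ((hasDerivAt_id s).smul_const d).const_add (φ p)
    have h2 := hasFDerivAt_comp_symm hφ.1 hy.1 (hasMFDerivAt_coord hψ.1 hy.2 i).mdifferentiableAt
    have h3 := h2.comp_hasDerivAt s h1
    refine h3.congr_deriv ?_
    exact (hψ.2 _ hy.2 _).1 ((hφ.mfderiv_symm_mem_iff hy.1 d).2 hdi) i hi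
  have hconst := constant_of_has_deriv_right_zero
    (fun s hs => (hder s hs).continuousAt.continuousWithinAt)
    (fun s hs => (hder s ⟨hs.1, hs.2.le⟩).hasDerivWithinAt) 1 (Set.right_mem_Icc.2 zero_le_one)
  have h4 : ψ (φ.symm (φ p + (1 : ℝ) • d)) i = ψ (φ.symm (φ p + (0 : ℝ) • d)) i := hconst
  rw [one_smul, zero_smul, add_zero, hd, add_sub_cancel, φ.left_inv hqφ, φ.left_inv hpφ] at h4
  exact h4

/-- The coordinate vector fields `∂/∂x^i`, `i < k`, of a chart. -/
def coordField (hk : k ≤ m) (φ : OpenPartialHomeomorph M (EuclideanSpace ℝ (Fin m))) (i : Fin k) :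
    ∀ q : M, TangentSpace (𝓡 m) q :=
  VectorField.mpullback (𝓡 m) (𝓡 m) φ fun _ =>
    (EuclideanSpace.single (Fin.castLE hk i) (1 : ℝ) : EuclideanSpace ℝ (Fin m))

lemma isInvertible_mfderiv_chart {φ : OpenPartialHomeomorph M (EuclideanSpace ℝ (Fin m))}
    (hφ : φ ∈ IsManifold.maximalAtlas (𝓡 m) ∞ M) {q : M} (hq : q ∈ φ.source) :
    (mfderiv (𝓡 m) (𝓡 m) φ q).IsInvertible :=
  ⟨(mdifferentiable_of_mem_maximalAtlas hφ).mfderiv hq, rfl⟩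

lemma inverse_mfderiv_chart_apply {φ : OpenPartialHomeomorph M (EuclideanSpace ℝ (Fin m))}
    (hφ : φ ∈ IsManifold.maximalAtlas (𝓡 m) ∞ M) {q : M} (hq : q ∈ φ.source)
    (d : TangentSpace (𝓡 m) (φ q)) :
    (mfderiv (𝓡 m) (𝓡 m) φ q).inverse d =
      mfderiv 𝓘(ℝ, EuclideanSpace ℝ (Fin m)) (𝓡 m) φ.symm (φ q) d := by
  have h2 : (mfderiv (𝓡 m) (𝓡 m) φ q).inverse d =
    ((mdifferentiable_of_mem_maximalAtlas hφ).mfderiv hq :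
      TangentSpace (𝓡 m) q →L[ℝ] TangentSpace (𝓡 m) (φ q)).inverse d := rfl
  rw [h2, ContinuousLinearMap.inverse_equiv]
  rfl

lemma coordField_apply (hk : k ≤ m) {φ : OpenPartialHomeomorph M (EuclideanSpace ℝ (Fin m))}
    (hφ : φ ∈ IsManifold.maximalAtlas (𝓡 m) ∞ M) {q : M} (hq : q ∈ φ.source) (i : Fin k) :
    coordField hk φ i q = mfderiv 𝓘(ℝ, EuclideanSpace ℝ (Fin m)) (𝓡 m) φ.symm (φ q)
      (EuclideanSpace.single (Fin.castLE hk i) (1 : ℝ) : EuclideanSpace ℝ (Fin m)) :=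
  inverse_mfderiv_chart_apply hφ hq _

variable [IsManifold (𝓡 m) ∞ M]

lemma smoothVectorFieldOn_coordField (hk : k ≤ m)
    {φ : OpenPartialHomeomorph M (EuclideanSpace ℝ (Fin m))}
    (hφ : φ ∈ IsManifold.maximalAtlas (𝓡 m) ∞ M) (i : Fin k) :
    SmoothVectorFieldOn (coordField hk φ i) φ.source := by
  intro q hq
  have hc := (contMDiffAt_vectorSpace_iff_contDiffAt (𝕜 := ℝ) (n := ∞) (x := φ q)
    (V := fun _ : EuclideanSpace ℝ (Fin m) =>
      (EuclideanSpace.single (Fin.castLE hk i) (1 : ℝ) : EuclideanSpace ℝ (Fin m)))).2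
    contDiffAt_const
  exact (ContMDiffAt.mpullback_vectorField_preimage hc (contMDiffAt_of_mem_maximalAtlas hφ hq)
    (isInvertible_mfderiv_chart hφ hq) (by simp)).contMDiffWithinAt

/-- A distribution with tangent charts is a smooth distribution: it is spanned by the coordinate
vector fields. -/
theorem isDistribution_of_tangentCharts (hk : k ≤ m) {D : TangentField m M}
    (hD : ∀ p : M, ∃ φ : OpenPartialHomeomorph M (EuclideanSpace ℝ (Fin m)),
      p ∈ φ.source ∧ IsTangentChart k D φ) : IsDistribution k D := by
  have hspan : ∀ (φ : OpenPartialHomeomorph M (EuclideanSpace ℝ (Fin m))),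
      IsTangentChart k D φ → ∀ q ∈ φ.source,
      D q = Submodule.span ℝ (Set.range fun i => coordField hk φ i q) ∧
        Module.finrank ℝ (D q) = k := by
    intro φ hφ q hq
    have h1 : D q = Submodule.span ℝ (Set.range fun i => coordField hk φ i q) := by
      refine le_antisymm (fun v hv => ?_) (Submodule.span_le.2 ?_)
      · set d : EuclideanSpace ℝ (Fin m) := mfderiv (𝓡 m) (𝓡 m) φ q v with hd
        have hdi : ∀ i : Fin m, k ≤ (i : ℕ) → d i = 0 := fun i hi => by
          rw [← (hφ.2 q hq v).1 hv i hi, mfderiv_coord hφ.1 hq]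
        have hds : d = ∑ i, d i • EuclideanSpace.single i (1 : ℝ) := by
          ext j
          simp [Pi.single_apply]
        have hv' : v = ∑ i, d i • (mfderiv 𝓘(ℝ, EuclideanSpace ℝ (Fin m)) (𝓡 m) φ.symm (φ q)
            (EuclideanSpace.single i (1 : ℝ)) : TangentSpace (𝓡 m) q) := by
          conv_lhs => rw [← mfderiv_symm_mfderiv hφ.1 hq v, ← hd, hds]
          exact (map_sum (mfderiv 𝓘(ℝ, EuclideanSpace ℝ (Fin m)) (𝓡 m) φ.symm (φ q)) _ _).trans
            (Finset.sum_congr rfl fun i _ => map_smul _ _ _)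
        rw [hv']
        refine Submodule.sum_mem _ fun i _ => ?_
        by_cases hi : (i : ℕ) < k
        · refine Submodule.smul_mem _ _ (Submodule.subset_span ⟨⟨i, hi⟩, ?_⟩)
          exact coordField_apply hk hφ.1 hq _
        · rw [hdi i (not_lt.1 hi), zero_smul]
          exact Submodule.zero_mem _
      · rintro _ ⟨i, rfl⟩
        have h2 := (hφ.mfderiv_symm_mem_iff (φ.map_source hq)
          (EuclideanSpace.single (Fin.castLE hk i) (1 : ℝ))).2 fun j hj => by
            rw [PiLp.single_apply, if_neg]
            rintro rfl
            exact absurd i.2 (not_lt.2 hj)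
        rw [φ.left_inv hq] at h2
        change coordField hk φ i q ∈ D q
        rw [coordField_apply hk hφ.1 hq]
        exact h2
    refine ⟨h1, ?_⟩
    have h3 : LinearIndependent ℝ fun i => coordField hk φ i q := by
      have h4 : LinearIndependent ℝ fun i : Fin k =>
          (EuclideanSpace.single (Fin.castLE hk i) (1 : ℝ) : EuclideanSpace ℝ (Fin m)) := by
        have := (EuclideanSpace.basisFun (Fin m) ℝ).toBasis.linearIndependent.comp _
          (Fin.castLE_injective hk)
        simpa [Function.comp_def] using this
      have h5 := h4.map' ((mdifferentiable_of_mem_maximalAtlas hφ.1).mfderiv hq).symm.toLinearMap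
        (LinearMap.ker_eq_bot.2 (ContinuousLinearEquiv.injective _))
      rw [show (fun i => coordField hk φ i q) = _ from funext (coordField_apply hk hφ.1 hq)]
      exact h5
    rw [h1, finrank_span_eq_card h3, Fintype.card_fin]
  refine ⟨fun p => ?_, fun p => ?_⟩
  · obtain ⟨φ, hp, hφ⟩ := hD p
    exact (hspan φ hφ p hp).2
  · obtain ⟨φ, hp, hφ⟩ := hD p
    exact ⟨φ.source, φ.open_source, hp, coordField hk φ,
      fun i => smoothVectorFieldOn_coordField hk hφ.1 i, fun q hq => (hspan φ hφ q hq).1⟩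

end FlatCharts

/-! ### Kernels of closed simple 2-forms on a manifold. -/

section SimpleFormsOnManifolds

variable {m : ℕ} {M : Type*} [TopologicalSpace M] [ChartedSpace (EuclideanSpace ℝ (Fin m)) M]
  {α β : OneForm m M}

lemma mem_kerInter {p : M} {v : TangentSpace (𝓡 m) p} :
    v ∈ kerInter α β p ↔ α p v = 0 ∧ β p v = 0 := Iff.rfl

/-- The derivative of `φ.symm` is surjective, so a pair of vectors detecting the form lifts to the
model space. -/
lemma inChart_wedge_ne_zero (h0 : ∀ p, α.wedge β p ≠ 0)
    {φ : OpenPartialHomeomorph M (EuclideanSpace ℝ (Fin m))}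
    (hφ : φ ∈ IsManifold.maximalAtlas (𝓡 m) ∞ M) {y : EuclideanSpace ℝ (Fin m)}
    (hy : y ∈ φ.target) : covectorWedge (α.inChart φ y) (β.inChart φ y) ≠ 0 := by
  obtain ⟨v, w, hvw⟩ := exists_covectorWedge_ne_zero (h0 (φ.symm y))
  intro h
  have hs : ∀ u : TangentSpace (𝓡 m) (φ.symm y), ∃ d : EuclideanSpace ℝ (Fin m),
      mfderiv 𝓘(ℝ, EuclideanSpace ℝ (Fin m)) (𝓡 m) φ.symm y d = u :=
    fun u => (mdifferentiable_of_mem_maximalAtlas hφ).symm.mfderiv_surjective hy u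
  obtain ⟨v', rfl⟩ := hs v
  obtain ⟨w', rfl⟩ := hs w
  exact hvw (congrArg (fun η : EuclideanSpace ℝ (Fin m) [⋀^Fin 2]→L[ℝ] ℝ => η ![v', w']) h)

variable [IsManifold (𝓡 m) ∞ M]

/-- The kernel of a nowhere-vanishing closed simple 2-form is involutive. -/
theorem isInvolutive_kerInter (hα : α.Smooth) (hβ : β.Smooth) (h0 : ∀ p, α.wedge β p ≠ 0)
    (hd : (α.wedge β).Closed) : IsInvolutive (kerInter α β) := by
  intro U hU V W hV hW hVk hWk p hp
  set c := chartAt (EuclideanSpace ℝ (Fin m)) p with hc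
  have hca : c ∈ atlas (EuclideanSpace ℝ (Fin m)) M := chart_mem_atlas _ p
  have hcm : c ∈ IsManifold.maximalAtlas (𝓡 m) ∞ M := IsManifold.chart_mem_maximalAtlas p
  have hpc : p ∈ c.source := mem_chart_source _ p
  have hyt : c p ∈ c.target := c.map_source hpc
  have : IsManifold (𝓡 m) 2 M := IsManifold.of_le (n := ∞) (by norm_cast)
  let T : (∀ p : M, TangentSpace (𝓡 m) p) → EuclideanSpace ℝ (Fin m) → EuclideanSpace ℝ (Fin m) :=
    fun V => VectorField.mpullback 𝓘(ℝ, EuclideanSpace ℝ (Fin m)) (𝓡 m) c.symm V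
  have hT : ∀ V : ∀ p : M, TangentSpace (𝓡 m) p, ∀ y ∈ c.target,
      mfderiv 𝓘(ℝ, EuclideanSpace ℝ (Fin m)) (𝓡 m) c.symm y (T V y) = V (c.symm y) := by
    intro V y hy
    have h1 : ((mdifferentiable_of_mem_maximalAtlas hcm).symm.mfderiv hy).toContinuousLinearMap =
        mfderiv 𝓘(ℝ, EuclideanSpace ℝ (Fin m)) (𝓡 m) c.symm y := rfl
    have h2 : T V y = (mfderiv 𝓘(ℝ, EuclideanSpace ℝ (Fin m)) (𝓡 m) c.symm y).inverse
      (V (c.symm y)) := rfl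
    rw [h2, ← h1, ContinuousLinearMap.inverse_equiv]
    exact ContinuousLinearEquiv.apply_symm_apply _ _
  have hTd : ∀ V : ∀ p : M, TangentSpace (𝓡 m) p, SmoothVectorFieldOn V U →
      DifferentiableAt ℝ (T V) (c p) := by
    intro V hV
    have h1 := MDifferentiableWithinAt.differentiableWithinAt_mpullbackWithin_vectorField
      (V := V) (s := Set.univ) (x := p) (I := 𝓡 m)
      (((hV p hp).contMDiffAt (hU.mem_nhds hp)).mdifferentiableAt (by simp)).mdifferentiableWithinAt
    simp at h1
    exact h1.differentiableAt Filter.univ_mem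
  have hker : ∀ V : ∀ p : M, TangentSpace (𝓡 m) p, (∀ p ∈ U, V p ∈ kerInter α β p) →
      ∀ᶠ y in 𝓝 (c p), α.inChart c y (T V y) = 0 ∧ β.inChart c y (T V y) = 0 := by
    intro V hV
    have hn : c.symm ⁻¹' U ∈ 𝓝 (c p) := by
      refine (c.continuousAt_symm hyt).preimage_mem_nhds ?_
      rw [c.left_inv hpc]; exact hU.mem_nhds hp
    filter_upwards [hn, c.open_target.mem_nhds hyt] with y hy hyt
    have := hV _ hy
    rw [← hT V y hyt] at this
    exact this
  have hbr := lieBracket_mem_ker_of_extDeriv_eq_zero (a := α.inChart c) (b := β.inChart c)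
    (((hα c hca).contDiffAt (c.open_target.mem_nhds hyt)).differentiableAt (by simp))
    (((hβ c hca).contDiffAt (c.open_target.mem_nhds hyt)).differentiableAt (by simp))
    (hd c hca (c p) hyt) (inChart_wedge_ne_zero h0 hcm hyt) (hTd V hV) (hTd W hW)
    (hker V hVk) (hker W hWk)
  let B : EuclideanSpace ℝ (Fin m) := VectorField.lieBracket ℝ (T V) (T W) (c p)
  -- The manifold bracket at `p` is by definition computed in the preferred chart at `p`, which is
  -- why `c` is that chart.
  have hfin : VectorField.mlieBracket (𝓡 m) V W p =
      mfderiv 𝓘(ℝ, EuclideanSpace ℝ (Fin m)) (𝓡 m) c.symm (c p) B := by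
    refine Eq.trans ?_ (inverse_mfderiv_chart_apply hcm hpc B)
    rw [← VectorField.mlieBracketWithin_univ, VectorField.mlieBracketWithin_apply]
    simp only [mfld_simps, VectorField.mpullbackWithin_univ, Set.univ_inter, Set.preimage_univ]
    have h1 : VectorField.lieBracketWithin ℝ (T V) (T W) Set.univ (c p) = B := by
      rw [VectorField.lieBracketWithin_univ]
    exact congrArg (fun d : EuclideanSpace ℝ (Fin m) =>
      (mfderiv (𝓡 m) (𝓡 m) c p).inverse (d : TangentSpace (𝓡 m) (c p))) h1
  have hmem : (mfderiv 𝓘(ℝ, EuclideanSpace ℝ (Fin m)) (𝓡 m) c.symm (c p) B) ∈ kerInter α β (c.symm (c p)) := hbr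
  rw [c.left_inv hpc] at hmem
  rw [hfin]
  exact hmem

end SimpleFormsOnManifolds

/-- The kernel of a nowhere-vanishing closed simple 2-form on a 4-manifold has tangent charts. -/
theorem exists_tangentChart_kerInter {M : Type*} [TopologicalSpace M]
    [ChartedSpace (EuclideanSpace ℝ (Fin 4)) M] [IsManifold (𝓡 4) ∞ M] {α β : OneForm 4 M}
    (hα : α.Smooth) (hβ : β.Smooth) (h0 : ∀ p, α.wedge β p ≠ 0) (hd : (α.wedge β).Closed)
    (p : M) : ∃ φ : OpenPartialHomeomorph M (EuclideanSpace ℝ (Fin 4)),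
      p ∈ φ.source ∧ IsTangentChart 2 (kerInter α β) φ := by
  set c := chartAt (EuclideanSpace ℝ (Fin 4)) p with hc
  have hca : c ∈ atlas (EuclideanSpace ℝ (Fin 4)) M := chart_mem_atlas _ p
  have hcm : c ∈ IsManifold.maximalAtlas (𝓡 4) ∞ M := IsManifold.chart_mem_maximalAtlas p
  have hpc : p ∈ c.source := mem_chart_source _ p
  obtain ⟨e, he0, hec, hes, hes', hek⟩ := exists_straightening_of_closed c.open_target
    (hα c hca) (hβ c hca) (fun z hz => inChart_wedge_ne_zero h0 hcm hz) (hd c hca)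
    (c.map_source hpc)
  have hφ : c.trans e ∈ IsManifold.maximalAtlas (𝓡 4) ∞ M := by
    refine (c.trans e).mem_maximalAtlas_of_contMDiffOn ?_ ?_
    · refine ContMDiffOn.comp (t := e.source) (g := e) (f := c) hes.contMDiffOn
        ((contMDiffOn_of_mem_maximalAtlas hcm).mono fun x hx => ?_) fun x hx => ?_
      · exact (c.trans_source e ▸ hx).1
      · exact (c.trans_source e ▸ hx).2
    · refine ContMDiffOn.comp (t := c.target) (g := c.symm) (f := e.symm) (contMDiffOn_symm_of_mem_maximalAtlas hcm)
        (hes'.contMDiffOn.mono fun x hx => ?_) fun x hx => ?_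
      · exact (c.trans_target e ▸ hx).1
      · exact (c.trans_target e ▸ hx).2
  refine ⟨c.trans e, by simp [hpc, he0], hφ, fun q hq v => ?_⟩
  have hqc : q ∈ c.source := (c.trans_source e ▸ hq).1
  have hqe : c q ∈ e.source := (c.trans_source e ▸ hq).2
  set d : EuclideanSpace ℝ (Fin 4) := mfderiv (𝓡 4) (𝓡 4) c q v with hdv
  have h1 : v ∈ kerInter α β q ↔ α.inChart c (c q) d = 0 ∧ β.inChart c (c q) d = 0 := by
    have h2 : (mfderiv 𝓘(ℝ, EuclideanSpace ℝ (Fin 4)) (𝓡 4) c.symm (c q) d) ∈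
        kerInter α β (c.symm (c q)) ↔ α.inChart c (c q) d = 0 ∧ β.inChart c (c q) d = 0 := Iff.rfl
    rw [← h2, hdv, mfderiv_symm_mfderiv hcm hqc, c.left_inv hqc]
  rw [h1, hek _ hqe]
  refine forall_congr' fun i => forall_congr' fun _ => ?_
  rw [mfderiv_coord hφ hq]
  have h3 : HasMFDerivAt (𝓡 4) (𝓡 4) (c.trans e) q ((fderiv ℝ e (c q)).comp
      (mfderiv (𝓡 4) (𝓡 4) c q)) := by
    have h4 := ((hes.contDiffAt (e.open_source.mem_nhds hqe)).differentiableAt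
      (by simp)).hasFDerivAt.hasMFDerivAt
    exact HasMFDerivAt.comp q (g := e) (f := c) h4
      ((mdifferentiable_of_mem_maximalAtlas hcm).mdifferentiableAt hqc).hasMFDerivAt
  rw [h3.mfderiv]
  rfl

/-! ### Locally constant functions and countability -/

/-- A function that is locally constant on a subset of a second countable space takes countably
many values there. -/
lemma countable_image_of_eventually_eq {X Z : Type*} [TopologicalSpace X]
    [SecondCountableTopology X] {A : Set X} {f : X → Z}
    (h : ∀ x ∈ A, ∀ᶠ y in 𝓝[A] x, f y = f x) : (f '' A).Countable := by
  obtain ⟨t, htA, ht, hA⟩ := TopologicalSpace.countable_cover_nhdsWithin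
    (f := fun x => {y | f y = f x}) h
  refine (ht.image f).mono ?_
  rintro _ ⟨x, hx, rfl⟩
  obtain ⟨y, hy, hxy⟩ := Set.mem_iUnion₂.1 (hA hx)
  exact ⟨y, hy, hxy.symm⟩

/-- `Z` carries no topology: it is used with `Prop` (membership in a union of plaques) and with `Set
M` (the leaf through a point). -/
lemma IsPreconnected.eq_of_eventually_eq {X Z : Type*} [TopologicalSpace X] {A : Set X}
    (hA : IsPreconnected A) {f : X → Z} (h : ∀ x ∈ A, ∀ᶠ y in 𝓝[A] x, f y = f x) {x y : X}
    (hx : x ∈ A) (hy : y ∈ A) : f x = f y := by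
  refine hA.induction₂ (fun x y => f x = f y) (fun x hx => ?_) (fun _ _ _ _ _ _ => Eq.trans)
    (fun _ _ _ _ => Eq.symm) hx hy
  filter_upwards [h x hx] with y hy using hy.symm

/-- The points reached in exactly `n` steps form a countable set, by induction on `n`. It serves to
count chains of plaques. -/
lemma countable_setOf_reflTransGen {X : Type*} {r : X → X → Prop}
    (hr : ∀ a, {b | r a b}.Countable) (a : X) : {b | Relation.ReflTransGen r a b}.Countable := by
  let S : ℕ → Set X := fun n => Nat.rec {a} (fun _ S => ⋃ c ∈ S, {b | r c b}) n
  have hS : ∀ n, (S n).Countable := by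
    intro n
    induction n with
    | zero => exact Set.countable_singleton a
    | succ n ih => exact ih.biUnion fun c _ => hr c
  refine (Set.countable_iUnion hS).mono fun b hb => ?_
  induction hb with
  | refl => exact Set.mem_iUnion.2 ⟨0, rfl⟩
  | tail _ hbc ih =>
    obtain ⟨n, hn⟩ := Set.mem_iUnion.1 ih
    exact Set.mem_iUnion.2 ⟨n + 1, Set.mem_iUnion₂.2 ⟨_, hn, hbc⟩⟩

/-- Two distinct points would force a whole interval, which has the cardinality of the continuum. -/
lemma IsPreconnected.subsingleton_of_countable {A : Set ℝ} (hA : IsPreconnected A)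
    (hc : A.Countable) : A.Subsingleton := by
  by_contra h
  obtain ⟨x, hx, y, hy, hxy⟩ := Set.not_subsingleton_iff.1 h
  wlog hlt : x < y generalizing x y
  · exact this y hy x hx hxy.symm (lt_of_le_of_ne (not_lt.1 hlt) hxy.symm)
  · have h1 := Cardinal.le_aleph0_iff_set_countable.2 (hc.mono (hA.Icc_subset hx hy))
    rw [Cardinal.mk_Icc_real hlt] at h1
    exact absurd h1 (not_le.2 Cardinal.aleph0_lt_continuum)

/-! ### The foliation integrating a distribution -/

section Foliations

variable {m k : ℕ} {M : Type*} [TopologicalSpace M]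

/-- The plaque through `p` of a chart. -/
def plaque (k : ℕ) (φ : OpenPartialHomeomorph M (EuclideanSpace ℝ (Fin m))) (p : M) : Set M :=
  {q ∈ φ.source | ∀ i : Fin m, k ≤ (i : ℕ) → φ q i = φ p i}

lemma plaque_eq_plaque {φ : OpenPartialHomeomorph M (EuclideanSpace ℝ (Fin m))} {p q : M}
    (h : ∀ i : Fin m, k ≤ (i : ℕ) → φ q i = φ p i) : plaque k φ q = plaque k φ p := by
  ext x
  refine and_congr_right fun _ => forall_congr' fun i => forall_congr' fun hi => ?_
  rw [h i hi]

/-- In coordinates the plaque is a slice of a convex set by an affine subspace. -/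
lemma isPathConnected_plaque {φ : OpenPartialHomeomorph M (EuclideanSpace ℝ (Fin m))}
    (hφ : Convex ℝ φ.target) {p : M} (hp : p ∈ φ.source) : IsPathConnected (plaque k φ p) := by
  have h1 : plaque k φ p =
      φ.symm '' (φ.target ∩ {y | ∀ i : Fin m, k ≤ (i : ℕ) → y i = φ p i}) := by
    ext q
    constructor
    · rintro ⟨hq, hqi⟩
      exact ⟨φ q, ⟨φ.map_source hq, hqi⟩, φ.left_inv hq⟩
    · rintro ⟨y, ⟨hy, hyi⟩, rfl⟩
      exact ⟨φ.map_target hy, by rwa [φ.right_inv hy]⟩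
  have h2 : Convex ℝ (φ.target ∩ {y | ∀ i : Fin m, k ≤ (i : ℕ) → y i = φ p i}) := by
    refine hφ.inter fun y hy z hz a b _ _ hab i hi => ?_
    rw [PiLp.add_apply, PiLp.smul_apply, PiLp.smul_apply, hy i hi, hz i hi, ← add_smul, hab,
      one_smul]
  rw [h1]
  refine (h2.isPathConnected ⟨φ p, φ.map_source hp, fun _ _ => rfl⟩).image' ?_
  exact φ.continuousOn_symm.mono Set.inter_subset_left

variable [ChartedSpace (EuclideanSpace ℝ (Fin m)) M]

/-- All points of the plaque share the transverse coordinates of `q`, so the comparison of charts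
may be based at `q` instead of `p`. -/
lemma IsTangentChart.eventually_eq_on_plaque {D : TangentField m M}
    {φ ψ : OpenPartialHomeomorph M (EuclideanSpace ℝ (Fin m))} (hφ : IsTangentChart k D φ)
    (hψ : IsTangentChart k D ψ) {p q : M} (hq : q ∈ plaque k φ p) (hqψ : q ∈ ψ.source) :
    ∀ᶠ x in 𝓝[plaque k φ p] q, x ∈ plaque k ψ q := by
  filter_upwards [nhdsWithin_le_nhds (hφ.eventually_transverse_eq hψ hq.1 hqψ),
    self_mem_nhdsWithin] with x hx hxp
  exact ⟨hx.2.1, hx.2.2 fun i hi => (hxp.2 i hi).trans (hq.2 i hi).symm⟩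

/-- The equivalence relation generated by lying in a common plaque of a tangent chart with convex
image. -/
def leafSetoid (k : ℕ) (D : TangentField m M) : Setoid M :=
  Relation.EqvGen.setoid fun p q => ∃ φ : OpenPartialHomeomorph M (EuclideanSpace ℝ (Fin m)),
    IsTangentChart k D φ ∧ Convex ℝ φ.target ∧ p ∈ φ.source ∧ q ∈ plaque k φ p

lemma leafSetoid_of_mem_plaque {D : TangentField m M}
    {φ : OpenPartialHomeomorph M (EuclideanSpace ℝ (Fin m))} (hφ : IsTangentChart k D φ)
    (hc : Convex ℝ φ.target) {p q : M} (hp : p ∈ φ.source) (hq : q ∈ plaque k φ p) :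
    leafSetoid k D p q :=
  Relation.EqvGen.rel _ _ ⟨φ, hφ, hc, hp, hq⟩

/-- Generating steps are joined inside a plaque, which lies in one class. The induction runs over
arbitrary related pairs, so membership in the leaf of `p` is carried as a hypothesis. -/
lemma isPathConnected_leaf {D : TangentField m M} (p : M) :
    IsPathConnected {q | leafSetoid k D q p} := by
  have key : ∀ x y, leafSetoid k D x y → leafSetoid k D x p →
      JoinedIn {q | leafSetoid k D q p} x y := by
    intro x y h
    induction h with
    | rel x y h =>
      intro hx
      obtain ⟨φ, hφ, hc, hxφ, hy⟩ := h
      refine ((isPathConnected_plaque (k := k) hc hxφ).joinedIn x ⟨hxφ, fun _ _ => rfl⟩ y hy).mono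
        fun z hz => ?_
      exact (leafSetoid k D).trans'
        ((leafSetoid k D).symm' (leafSetoid_of_mem_plaque hφ hc hxφ hz)) hx
    | refl x => exact fun hx => JoinedIn.refl hx
    | symm x y h ih => exact fun hy => (ih ((leafSetoid k D).trans' h hy)).symm
    | trans x y z h h' ih ih' =>
      exact fun hx => (ih hx).trans (ih' ((leafSetoid k D).trans' ((leafSetoid k D).symm' h) hx))
  exact ⟨p, (leafSetoid k D).refl' p, fun {y} hy =>
    key p y ((leafSetoid k D).symm' hy) ((leafSetoid k D).refl' p)⟩

/-- A leaf meets a tangent chart in countably many plaques. -/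
lemma countable_transverse_image_leaf [SecondCountableTopology M] {D : TangentField m M}
    (hD : ∀ p : M, ∃ φ : OpenPartialHomeomorph M (EuclideanSpace ℝ (Fin m)),
      p ∈ φ.source ∧ IsTangentChart k D φ ∧ Convex ℝ φ.target)
    {φ : OpenPartialHomeomorph M (EuclideanSpace ℝ (Fin m))} (hφ : IsTangentChart k D φ) (p : M)
    {i : Fin m} (hi : k ≤ (i : ℕ)) :
    ((fun x => φ x i) '' (φ.source ∩ {q | leafSetoid k D q p})).Countable := by
  choose Φ hΦs hΦ hΦc using hD
  obtain ⟨S, hS, hcov⟩ := TopologicalSpace.countable_cover_nhds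
    fun x => (Φ x).open_source.mem_nhds (hΦs x)
  have hcov' : ∀ q, ∃ x ∈ S, q ∈ (Φ x).source := fun q => by
    simpa using hcov.ge (Set.mem_univ q)
  let IsPl : Set M → Prop := fun P => ∃ x ∈ S, ∃ q ∈ (Φ x).source, P = plaque k (Φ x) q
  -- A graph on the plaques of countably many charts covering `M`, with edges between plaques that
  -- meet. Each vertex has countably many neighbours, since on a plaque the plaque of another chart
  -- through a point is locally constant.
  let adj : Set M → Set M → Prop := fun P Q => IsPl P ∧ IsPl Q ∧ (P ∩ Q).Nonempty
  have hadj : ∀ P, {Q | adj P Q}.Countable := by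
    intro P
    by_cases hP : IsPl P
    swap
    · exact Set.countable_empty.mono fun Q hQ => hP hQ.1
    obtain ⟨x, -, q, hq, rfl⟩ := hP
    refine (hS.biUnion (t := fun y _ =>
      (fun z => plaque k (Φ y) z) '' (plaque k (Φ x) q ∩ (Φ y).source)) fun y _ => ?_).mono ?_
    · refine countable_image_of_eventually_eq fun z hz => ?_
      filter_upwards [nhdsWithin_mono _ Set.inter_subset_left
        ((hΦ x).eventually_eq_on_plaque (hΦ y) hz.1 hz.2)] with w hw
      exact plaque_eq_plaque hw.2
    · rintro Q ⟨-, ⟨y, hy, w, hw, rfl⟩, z, hzP, hzQ⟩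
      exact Set.mem_iUnion₂.2 ⟨y, hy, z, ⟨hzP, hzQ.1⟩, plaque_eq_plaque hzQ.2⟩
  obtain ⟨x₀, hx₀, hpx₀⟩ := hcov' p
  have hP₀ : IsPl (plaque k (Φ x₀) p) := ⟨x₀, hx₀, p, hpx₀, rfl⟩
  let reach : Set (Set M) := {P | Relation.ReflTransGen adj (plaque k (Φ x₀) p) P}
  have h_count : reach.Countable := countable_setOf_reflTransGen hadj _
  have h_pl : ∀ P ∈ reach, IsPl P := by
    intro P hP
    rcases Relation.ReflTransGen.cases_tail hP with h | ⟨_, _, h⟩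
    · exact h ▸ hP₀
    · exact h.2.1
  -- The union of the reachable plaques is saturated. The generating plaques come from arbitrary
  -- charts `χ`, not only the chosen ones, but membership in the union is locally constant along
  -- each of them, and they are connected.
  have hR : ∀ x y, leafSetoid k D x y → (x ∈ ⋃₀ reach ↔ y ∈ ⋃₀ reach) := by
    intro x y h
    induction h with
    | rel x y h =>
      obtain ⟨χ, hχ, hc, hxχ, hy⟩ := h
      have hpre := (isPathConnected_plaque (k := k) hc hxχ).isConnected.isPreconnected
      refine iff_of_eq (IsPreconnected.eq_of_eventually_eq hpre (f := fun z => z ∈ ⋃₀ reach)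
        (fun z hz => ?_) ⟨hxχ, fun _ _ => rfl⟩ hy)
      obtain ⟨s, hs, hzs⟩ := hcov' z
      have hQ : IsPl (plaque k (Φ s) z) := ⟨s, hs, z, hzs, rfl⟩
      filter_upwards [hχ.eventually_eq_on_plaque (hΦ s) hz hzs] with w hw
      have hz' : z ∈ plaque k (Φ s) z := ⟨hzs, fun _ _ => rfl⟩
      refine propext ⟨?_, ?_⟩
      · rintro ⟨P, hP, hwP⟩
        exact ⟨_, Relation.ReflTransGen.tail hP ⟨h_pl P hP, hQ, w, hwP, hw⟩, hz'⟩
      · rintro ⟨P, hP, hzP⟩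
        exact ⟨_, Relation.ReflTransGen.tail hP ⟨h_pl P hP, hQ, z, hzP, hz'⟩, hw⟩
    | refl x => exact Iff.rfl
    | symm x y _ ih => exact ih.symm
    | trans x y z _ _ ih ih' => exact ih.trans ih'
  have hpR : p ∈ ⋃₀ reach := ⟨_, Relation.ReflTransGen.refl, hpx₀, fun _ _ => rfl⟩
  refine (h_count.biUnion (t := fun P _ => (fun x => φ x i) '' (P ∩ φ.source)) fun P hP => ?_).mono ?_
  · obtain ⟨x, -, q, hq, rfl⟩ := h_pl P hP
    refine countable_image_of_eventually_eq fun z hz => ?_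
    filter_upwards [nhdsWithin_mono _ Set.inter_subset_left
      ((hΦ x).eventually_eq_on_plaque hφ hz.1 hz.2)] with w hw
    exact hw.2 i hi
  · rintro _ ⟨q, ⟨hqφ, hqp⟩, rfl⟩
    obtain ⟨P, hP, hqP⟩ := (hR q p hqp).2 hpR
    exact Set.mem_iUnion₂.2 ⟨P, hP, q, ⟨hqP, hqφ⟩, rfl⟩

/-- Tangent charts can be shrunk to have a convex image. -/
lemma IsTangentChart.exists_convex [IsManifold (𝓡 m) ∞ M] {D : TangentField m M}
    {φ : OpenPartialHomeomorph M (EuclideanSpace ℝ (Fin m))} (hφ : IsTangentChart k D φ) {p : M}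
    (hp : p ∈ φ.source) : ∃ ψ : OpenPartialHomeomorph M (EuclideanSpace ℝ (Fin m)),
      p ∈ ψ.source ∧ IsTangentChart k D ψ ∧ Convex ℝ ψ.target := by
  obtain ⟨r, hr, hball⟩ := Metric.isOpen_iff.1 φ.open_target _ (φ.map_source hp)
  have hs : IsOpen (φ.source ∩ φ ⁻¹' Metric.ball (φ p) r) :=
    φ.isOpen_inter_preimage Metric.isOpen_ball
  let ψ := φ.restrOpen _ hs
  have hsrc : ψ.source ⊆ φ.source := fun x hx => hx.1
  have htgt : ψ.target = Metric.ball (φ p) r := by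
    ext y
    constructor
    · rintro ⟨hy, -, hy'⟩
      rw [Set.mem_preimage] at hy'
      rwa [show φ (φ.symm y) = y from φ.right_inv hy] at hy'
    · intro hy
      refine ⟨hball hy, φ.map_target (hball hy), ?_⟩
      rw [Set.mem_preimage]
      rwa [show φ (φ.symm y) = y from φ.right_inv (hball hy)]
  refine ⟨ψ, ⟨hp, hp, Metric.mem_ball_self hr⟩, ⟨?_, fun q hq v => hφ.2 q (hsrc hq) v⟩, ?_⟩
  · refine ψ.mem_maximalAtlas_of_contMDiffOn ?_ ?_
    · exact (contMDiffOn_of_mem_maximalAtlas hφ.1).mono hsrc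
    · exact (contMDiffOn_symm_of_mem_maximalAtlas hφ.1).mono fun y hy => hball (htgt ▸ hy)
  · rw [htgt]; exact convex_ball _ _

/-- Tangent charts with convex image are distinguished by the leaves. -/
lemma isDistinguishedChart_leaves [SecondCountableTopology M] {D : TangentField m M}
    (hD : ∀ p : M, ∃ φ : OpenPartialHomeomorph M (EuclideanSpace ℝ (Fin m)),
      p ∈ φ.source ∧ IsTangentChart k D φ ∧ Convex ℝ φ.target)
    {φ : OpenPartialHomeomorph M (EuclideanSpace ℝ (Fin m))} (hφ : IsTangentChart k D φ)
    (hc : Convex ℝ φ.target) : IsDistinguishedChart k (leafSetoid k D).classes φ := by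
  refine ⟨hφ.1, ?_⟩
  rintro _ ⟨o, rfl⟩ p ⟨hpφ, hpo⟩
  refine Set.Subset.antisymm (fun q hq => ?_) ?_
  · have hsub := connectedComponentIn_subset (φ.source ∩ {x | leafSetoid k D x o}) p
    refine ⟨(hsub hq).1, fun i hi => ?_⟩
    have hcont : ContinuousOn (fun x => φ x i)
        (connectedComponentIn (φ.source ∩ {x | leafSetoid k D x o}) p) :=
      (EuclideanSpace.proj i : EuclideanSpace ℝ (Fin m) →L[ℝ] ℝ).continuous.comp_continuousOn
        (φ.continuousOn.mono fun x hx => (hsub hx).1)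
    -- The transverse coordinate maps the component onto a connected countable subset of `ℝ`, hence
    -- a point.
    have hpre := isPreconnected_connectedComponentIn.image _ hcont
    exact IsPreconnected.subsingleton_of_countable hpre
      ((countable_transverse_image_leaf hD hφ o hi).mono (Set.image_mono hsub))
      ⟨q, hq, rfl⟩ ⟨p, mem_connectedComponentIn ⟨hpφ, hpo⟩, rfl⟩
  · refine (isPathConnected_plaque hc hpφ).isConnected.isPreconnected.subset_connectedComponentIn
      ⟨hpφ, fun _ _ => rfl⟩ fun q hq => ⟨hq.1, ?_⟩
    exact (leafSetoid k D).trans'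
      ((leafSetoid k D).symm' (leafSetoid_of_mem_plaque hφ hc hpφ hq)) hpo

/-- **Frobenius theorem**, global version: a distribution with tangent charts is integrated by a
foliation. -/
theorem isFoliationOf_leaves [IsManifold (𝓡 m) ∞ M] [SecondCountableTopology M] {D : TangentField m M}
    (hD : ∀ p : M, ∃ φ : OpenPartialHomeomorph M (EuclideanSpace ℝ (Fin m)),
      p ∈ φ.source ∧ IsTangentChart k D φ) :
    IsFoliationOf k D (leafSetoid k D).classes := by
  have hD' : ∀ p : M, ∃ φ : OpenPartialHomeomorph M (EuclideanSpace ℝ (Fin m)),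
      p ∈ φ.source ∧ IsTangentChart k D φ ∧ Convex ℝ φ.target := fun p => by
    obtain ⟨φ, hp, hφ⟩ := hD p
    exact hφ.exists_convex hp
  refine ⟨⟨Setoid.isPartition_classes _, ?_, fun p => ?_⟩, fun p => ?_⟩
  · rintro _ ⟨p, rfl⟩
    exact isPathConnected_leaf p
  · obtain ⟨φ, hp, hφ, hc⟩ := hD' p
    exact ⟨φ, hp, isDistinguishedChart_leaves hD' hφ hc⟩
  · obtain ⟨φ, hp, hφ, hc⟩ := hD' p
    exact ⟨φ, hp, isDistinguishedChart_leaves hD' hφ hc, hφ.2⟩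

/-- Two leaves with a common point of foliations integrating the same distribution are
contained in each other. -/
lemma IsFoliationOf.leaf_subset {D : TangentField m M} {ℱ ℱ' : Set (Set M)}
    (h : IsFoliationOf k D ℱ) (h' : IsFoliationOf k D ℱ') {L L' : Set M} (hL : L ∈ ℱ)
    (hL' : L' ∈ ℱ') {p : M} (hp : p ∈ L) (hp' : p ∈ L') : L ⊆ L' := by
  intro q hq
  obtain ⟨γ, hγ⟩ := (h.1.2.1 L hL).joinedIn p hp q hq
  choose leaf hleaf huniq using h'.1.1.2
  have hγL : ∀ t, γ.extend t ∈ L := fun t => hγ _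
  -- The leaf of `ℱ'` through the moving point of the path is shown to be locally constant in time.
  have hloc : ∀ t ∈ (Set.univ : Set ℝ), ∀ᶠ s in 𝓝[Set.univ] t,
      leaf (γ.extend s) = leaf (γ.extend t) := by
    intro t _
    rw [nhdsWithin_univ]
    obtain ⟨φ, hφp, hφ, hφD⟩ := h.2 (γ.extend t)
    obtain ⟨ψ, hψp, hψ, hψD⟩ := h'.2 (γ.extend t)
    have htc : γ.extend ⁻¹' φ.source ∈ 𝓝 t :=
      γ.continuous_extend.continuousAt.preimage_mem_nhds (φ.open_source.mem_nhds hφp)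
    -- A connected neighbourhood of `t` has its image in one component of `φ.source ∩ L`, that is,
    -- in one plaque of `φ`. Close to `t` this plaque lies in a plaque of `ψ`, hence in a single
    -- leaf of `ℱ'`.
    have hcc : connectedComponentIn (γ.extend ⁻¹' φ.source) t ∈ 𝓝 t :=
      connectedComponentIn_mem_nhds htc
    have hev := IsTangentChart.eventually_transverse_eq ⟨hφ.1, hφD⟩ ⟨hψ.1, hψD⟩ hφp hψp
    filter_upwards [hcc, γ.continuous_extend.continuousAt.eventually hev] with s hs hsev
    have hpre : IsPreconnected (γ.extend '' connectedComponentIn (γ.extend ⁻¹' φ.source) t) :=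
      isPreconnected_connectedComponentIn.image _ γ.continuous_extend.continuousOn
    have hsub := hpre.subset_connectedComponentIn (F := φ.source ∩ L)
      ⟨t, mem_connectedComponentIn hφp, rfl⟩ (by
        rintro _ ⟨r, hr, rfl⟩
        exact ⟨connectedComponentIn_subset (γ.extend ⁻¹' φ.source) t hr, hγL r⟩)
    have hsφ : γ.extend s ∈ connectedComponentIn (φ.source ∩ L) (γ.extend t) := hsub ⟨s, hs, rfl⟩
    rw [hφ.2 L hL _ ⟨hφp, hγL t⟩] at hsφ
    have hsψ : γ.extend s ∈ {q ∈ ψ.source | ∀ i : Fin m, k ≤ (i : ℕ) →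
        ψ q i = ψ (γ.extend t) i} := ⟨hsev.2.1, hsev.2.2 hsφ.2⟩
    rw [← hψ.2 _ (hleaf (γ.extend t)).1 _ ⟨hψp, (hleaf (γ.extend t)).2⟩] at hsψ
    exact (huniq (γ.extend s) _
      ⟨(hleaf (γ.extend t)).1, (connectedComponentIn_subset _ _ hsψ).2⟩).symm
  have heq := IsPreconnected.eq_of_eventually_eq isPreconnected_univ hloc (Set.mem_univ (0 : ℝ))
    (Set.mem_univ (1 : ℝ))
  rw [γ.extend_zero, γ.extend_one] at heq
  rw [huniq p L' ⟨hL', hp'⟩, heq]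
  exact (hleaf q).2

/-- A foliation is determined by its tangent distribution. -/
theorem IsFoliationOf.unique {D : TangentField m M} {ℱ ℱ' : Set (Set M)}
    (h : IsFoliationOf k D ℱ) (h' : IsFoliationOf k D ℱ') : ℱ = ℱ' := by
  have key : ∀ {ℱ ℱ' : Set (Set M)}, IsFoliationOf k D ℱ → IsFoliationOf k D ℱ' → ℱ ⊆ ℱ' := by
    intro ℱ ℱ' h h' L hL
    obtain ⟨p, hp⟩ := (h.1.2.1 L hL).nonempty
    obtain ⟨L', ⟨hL', hpL'⟩, -⟩ := h'.1.1.2 p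
    have : L = L' := Set.Subset.antisymm (h.leaf_subset h' hL hL' hp hpL')
      (h'.leaf_subset h hL' hL hpL' hp)
    exact this ▸ hL'
  exact Set.Subset.antisymm (key h h') (key h' h)

end Foliations

/-! ### The Hodge dual of a simple 2-form -/

section HodgeDual

variable {M : Type*} [TopologicalSpace M] [ChartedSpace (EuclideanSpace ℝ (Fin 4)) M]

lemma sum_coordCovector_smul_coordVector (p : M) (v : TangentSpace (𝓡 4) p) :
    ∑ a, coordCovector p a v • coordVector p a = v := by
  have h : ∀ v : EuclideanSpace ℝ (Fin 4), ∑ a, v a • EuclideanSpace.single a (1 : ℝ) = v := by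
    intro v
    ext j
    simp [Pi.single_apply]
  exact h v

/-- Converts the index sums in the definition of `hodgeStar` into values on vectors. -/
lemma sum_sum_coord_bilinear (p : M)
    (T : TangentSpace (𝓡 4) p →ₗ[ℝ] TangentSpace (𝓡 4) p →ₗ[ℝ] ℝ) (x y : Fin 4 → ℝ) :
    ∑ a, ∑ b, T (coordVector p a) (coordVector p b) * (x a * y b) =
      T (∑ a, x a • coordVector p a) (∑ b, y b • coordVector p b) := by
  simp only [map_sum, map_smul, LinearMap.sum_apply, LinearMap.smul_apply, smul_eq_mul,
    Finset.mul_sum]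
  rw [Finset.sum_comm]
  exact Finset.sum_congr rfl fun a _ => Finset.sum_congr rfl fun b _ => by ring

lemma update_vec_four {V : Type*} (x y z t a : V) :
    Function.update ![x, y, z, t] 0 a = ![a, y, z, t] ∧
      Function.update ![x, y, z, t] 1 a = ![x, a, z, t] ∧
      Function.update ![x, y, z, t] 2 a = ![x, y, a, t] ∧
      Function.update ![x, y, z, t] 3 a = ![x, y, z, a] := by
  refine ⟨?_, ?_, ?_, ?_⟩ <;> funext i <;> fin_cases i <;> rfl

/-- A 4-form as a bilinear form in the first two arguments. -/
def bilinearFst {V : Type*} [AddCommGroup V] [Module ℝ V] [TopologicalSpace V]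
    (η : V [⋀^Fin 4]→L[ℝ] ℝ) (z t : V) : V →ₗ[ℝ] V →ₗ[ℝ] ℝ :=
  LinearMap.mk₂ ℝ (fun x y => η ![x, y, z, t])
    (fun x₁ x₂ y => by
      simpa only [update_vec_four] using η.map_update_add ![x₁, y, z, t] 0 x₁ x₂)
    (fun c x y => by
      simpa only [update_vec_four] using η.map_update_smul ![x, y, z, t] 0 c x)
    (fun x y₁ y₂ => by
      simpa only [update_vec_four] using η.map_update_add ![x, y₁, z, t] 1 y₁ y₂)
    (fun c x y => by
      simpa only [update_vec_four] using η.map_update_smul ![x, y, z, t] 1 c y)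

/-- A 4-form as a bilinear form in the last two arguments. -/
def bilinearSnd {V : Type*} [AddCommGroup V] [Module ℝ V] [TopologicalSpace V]
    (η : V [⋀^Fin 4]→L[ℝ] ℝ) (x y : V) : V →ₗ[ℝ] V →ₗ[ℝ] ℝ :=
  LinearMap.mk₂ ℝ (fun z t => η ![x, y, z, t])
    (fun z₁ z₂ t => by
      simpa only [update_vec_four] using η.map_update_add ![x, y, z₁, t] 2 z₁ z₂)
    (fun c z t => by
      simpa only [update_vec_four] using η.map_update_smul ![x, y, z, t] 2 c z)
    (fun z t₁ t₂ => by
      simpa only [update_vec_four] using η.map_update_add ![x, y, z, t₁] 3 t₁ t₂)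
    (fun c z t => by
      simpa only [update_vec_four] using η.map_update_smul ![x, y, z, t] 3 c t)

lemma bilinearFst_apply {V : Type*} [AddCommGroup V] [Module ℝ V] [TopologicalSpace V]
    (η : V [⋀^Fin 4]→L[ℝ] ℝ) (x y z t : V) : bilinearFst η z t x y = η ![x, y, z, t] := rfl

lemma bilinearSnd_apply {V : Type*} [AddCommGroup V] [Module ℝ V] [TopologicalSpace V]
    (η : V [⋀^Fin 4]→L[ℝ] ℝ) (x y z t : V) : bilinearSnd η x y z t = η ![x, y, z, t] := rfl

lemma bilinearFst_swap {V : Type*} [AddCommGroup V] [Module ℝ V] [TopologicalSpace V]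
    (η : V [⋀^Fin 4]→L[ℝ] ℝ) (x y z t : V) : η ![y, x, z, t] = -η ![x, y, z, t] := by
  have := η.toAlternatingMap.map_swap ![x, y, z, t] (show (0 : Fin 4) ≠ 1 by decide)
  rw [← ContinuousAlternatingMap.coe_toAlternatingMap, ← this]
  congr 1
  ext i; fin_cases i <;> rfl

lemma bilinearSnd_swap {V : Type*} [AddCommGroup V] [Module ℝ V] [TopologicalSpace V]
    (η : V [⋀^Fin 4]→L[ℝ] ℝ) (x y z t : V) : η ![x, y, t, z] = -η ![x, y, z, t] := by
  have := η.toAlternatingMap.map_swap ![x, y, z, t] (show (2 : Fin 4) ≠ 3 by decide)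
  rw [← ContinuousAlternatingMap.coe_toAlternatingMap, ← this]
  congr 1
  ext i; fin_cases i <;> rfl

lemma finrank_tangentSpace (p : M) : Module.finrank ℝ (TangentSpace (𝓡 4) p) = 4 :=
  finrank_euclideanSpace_fin (𝕜 := ℝ) (n := 4)

lemma exists_notMem_span {p : M} {n : ℕ} (hn : n < 4) (v : Fin n → TangentSpace (𝓡 4) p) :
    ∃ w, w ∉ Submodule.span ℝ (Set.range v) := by
  by_contra! h
  have h1 := finrank_range_le_card (R := ℝ) v
  have h2 : Submodule.span ℝ (Set.range v) = ⊤ := eq_top_iff.2 fun x _ => h x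
  rw [Set.finrank, h2, finrank_top, finrank_tangentSpace, Fintype.card_fin] at h1
  omega

lemma linearIndependent_coordVector (p : M) : LinearIndependent ℝ (coordVector p) := by
  have h := (EuclideanSpace.basisFun (Fin 4) ℝ).toBasis.linearIndependent
  have h1 : ((EuclideanSpace.basisFun (Fin 4) ℝ).toBasis : Fin 4 → EuclideanSpace ℝ (Fin 4)) =
      fun a => EuclideanSpace.single a (1 : ℝ) := by ext1 a; simp
  rw [h1] at h
  exact h

variable [IsManifold (𝓡 4) ∞ M]

/-- The components `g^{ca} α_a` of the vector field metrically equivalent to a 1-form. -/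
def LorentzMetric.sharpCoord (g : LorentzMetric M) (α : OneForm 4 M) (p : M) (c : Fin 4) : ℝ :=
  ∑ a, (g.gram p)⁻¹ c a * α p (coordVector p a)

/-- The vector field metrically equivalent to a 1-form. -/
def LorentzMetric.sharp (g : LorentzMetric M) (α : OneForm 4 M) (p : M) : TangentSpace (𝓡 4) p :=
  ∑ c, g.sharpCoord α p c • coordVector p c

lemma LorentzMetric.raise_wedge (g : LorentzMetric M) (α β : OneForm 4 M) (p : M) (c d : Fin 4) :
    g.raise (α.wedge β) p c d = g.sharpCoord α p c * g.sharpCoord β p d -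
      g.sharpCoord β p c * g.sharpCoord α p d := by
  have h : ∀ a b, (α.wedge β) p ![coordVector p a, coordVector p b] =
      α p (coordVector p a) * β p (coordVector p b) -
        α p (coordVector p b) * β p (coordVector p a) := fun _ _ => rfl
  simp only [LorentzMetric.raise, LorentzMetric.sharpCoord, h, Finset.sum_mul_sum,
    ← Finset.sum_sub_distrib]
  exact Finset.sum_congr rfl fun a _ => Finset.sum_congr rfl fun b _ => by ring

/-- The Hodge dual of `α ∧ β` is the interior product of the volume form with the vector fields
metrically equivalent to `α` and `β`. -/
theorem LorentzMetric.hodgeStar_wedge_apply (g : LorentzMetric M) (ε : DiffForm 4 4 M)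
    (α β : OneForm 4 M) (p : M) (v w : TangentSpace (𝓡 4) p) :
    g.hodgeStar ε (α.wedge β) p ![v, w] = ε p ![v, w, g.sharp α p, g.sharp β p] := by
  have h1 : ∀ x y : TangentSpace (𝓡 4) p, (1 / 2 : ℝ) * ∑ c, ∑ d,
      ε p ![x, y, coordVector p c, coordVector p d] * g.raise (α.wedge β) p c d =
        ε p ![x, y, g.sharp α p, g.sharp β p] := by
    intro x y
    have h2 := sum_sum_coord_bilinear p (bilinearSnd (ε p) x y) (g.sharpCoord α p)
      (g.sharpCoord β p)
    have h3 := sum_sum_coord_bilinear p (bilinearSnd (ε p) x y) (g.sharpCoord β p)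
      (g.sharpCoord α p)
    simp only [bilinearSnd_apply] at h2 h3
    simp only [LorentzMetric.raise_wedge, mul_sub, Finset.sum_sub_distrib]
    rw [h2, h3]
    -- Antisymmetry makes the two terms equal and absorbs the factor ½. The same happens below with
    -- the outer ½ and the first two slots.
    change 1 / 2 * ε p ![x, y, g.sharp α p, g.sharp β p] -
      1 / 2 * ε p ![x, y, g.sharp β p, g.sharp α p] = _
    rw [bilinearSnd_swap (ε p) x y (g.sharp α p)]
    ring
  have h4 : g.hodgeStar ε (α.wedge β) p ![v, w] = (1 / 2 : ℝ) * ∑ a, ∑ b,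
      ε p ![coordVector p a, coordVector p b, g.sharp α p, g.sharp β p] *
        (coordCovector p a v * coordCovector p b w - coordCovector p a w * coordCovector p b v) := by
    simp only [LorentzMetric.hodgeStar, h1]
    rw [ContinuousAlternatingMap.smul_apply, ContinuousAlternatingMap.sum_apply]
    simp only [ContinuousAlternatingMap.sum_apply]
    rfl
  have h5 := sum_sum_coord_bilinear p (bilinearFst (ε p) (g.sharp α p) (g.sharp β p))
    (fun a => coordCovector p a v) (fun a => coordCovector p a w)
  have h6 := sum_sum_coord_bilinear p (bilinearFst (ε p) (g.sharp α p) (g.sharp β p))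
    (fun a => coordCovector p a w) (fun a => coordCovector p a v)
  simp only [bilinearFst_apply, sum_coordCovector_smul_coordVector] at h5 h6
  rw [h4]
  simp only [mul_sub, Finset.sum_sub_distrib]
  rw [h5, h6, bilinearFst_swap (ε p) v w]
  ring

/-- In the basis given by the signature, pairing with `b i` returns the `i`-th coordinate up to
sign. -/
lemma LorentzMetric.eq_zero_of_inner_eq_zero (g : LorentzMetric M) {p : M}
    {x : TangentSpace (𝓡 4) p} (h : ∀ y, g.inner p y x = 0) : x = 0 := by
  obtain ⟨b, hb⟩ := g.signature p
  have h1 : ∀ i, b.repr x i = 0 := by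
    intro i
    have h2 := h (b i)
    rw [← b.sum_repr x, map_sum] at h2
    simp only [map_smul, hb, smul_eq_mul] at h2
    rw [Finset.sum_eq_single i (fun j _ hj => by rw [if_neg hj.symm, mul_zero]) (by simp),
      if_pos rfl] at h2
    exact (mul_eq_zero.1 h2).resolve_right (by split_ifs <;> norm_num)
  rw [← b.sum_repr x]
  simp [h1]

/-- A null vector of the Gram matrix gives a combination of the `v j` orthogonal to a basis, hence
zero by nondegeneracy, against independence. -/
lemma LorentzMetric.det_ne_zero (g : LorentzMetric M) {p : M}
    {v : Fin 4 → TangentSpace (𝓡 4) p} (hv : LinearIndependent ℝ v) :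
    (Matrix.of fun i j => g.inner p (v i) (v j)).det ≠ 0 := by
  intro h0
  obtain ⟨x, hx, hx0⟩ := Matrix.exists_mulVec_eq_zero_iff.2 h0
  have hspan := hv.span_eq_top_of_card_eq_finrank (by rw [finrank_tangentSpace]; simp)
  have h1 : ∀ y, g.inner p y (∑ j, x j • v j) = 0 := by
    intro y
    have hy : y ∈ Submodule.span ℝ (Set.range v) := hspan ▸ Submodule.mem_top
    induction hy using Submodule.span_induction with
    | mem y hy =>
      obtain ⟨i, rfl⟩ := hy
      have := congrFun hx0 i
      rw [map_sum]
      simp only [map_smul, smul_eq_mul]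
      simpa [Matrix.mulVec, dotProduct, mul_comm] using this
    | zero => simp
    | add y z _ _ hy hz => rw [map_add, add_apply, hy, hz, add_zero]
    | smul c y _ hy => rw [map_smul, smul_apply, hy, smul_zero]
  have h2 := g.eq_zero_of_inner_eq_zero h1
  exact hx (funext fun i => Fintype.linearIndependent_iff.1 hv x h2 i)

/-- `g(u, ♯α) = α(u)`. -/
lemma LorentzMetric.inner_sharp (g : LorentzMetric M) (α : OneForm 4 M) (p : M)
    (u : TangentSpace (𝓡 4) p) : g.inner p u (g.sharp α p) = α p u := by
  have hdet : IsUnit (g.gram p).det :=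
    isUnit_iff_ne_zero.2 (g.det_ne_zero (linearIndependent_coordVector p))
  have h1 : ∀ b, g.inner p (coordVector p b) (g.sharp α p) = α p (coordVector p b) := by
    intro b
    have h2 : g.inner p (coordVector p b) (g.sharp α p) =
        ((g.gram p).mulVec ((g.gram p)⁻¹.mulVec fun a => α p (coordVector p a))) b := by
      rw [LorentzMetric.sharp, map_sum]
      simp only [map_smul, smul_eq_mul]
      exact Finset.sum_congr rfl fun c _ => mul_comm _ _
    rw [h2, Matrix.mulVec_mulVec, Matrix.mul_nonsing_inv _ hdet, Matrix.one_mulVec]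
  conv_lhs => rw [← sum_coordCovector_smul_coordVector p u]
  conv_rhs => rw [← sum_coordCovector_smul_coordVector p u]
  simp only [map_sum, map_smul, sum_apply, smul_apply, h1]

/-- Pairing with `u` turns a relation between `♯α` and `♯β` into one between `α` and `β`, which a
nonzero wedge excludes. -/
lemma LorentzMetric.linearIndependent_sharp (g : LorentzMetric M) {α β : OneForm 4 M} {p : M}
    (h : α.wedge β p ≠ 0) : LinearIndependent ℝ ![g.sharp α p, g.sharp β p] := by
  rw [LinearIndependent.pair_iff]
  intro s t hst
  have h1 : ∀ u, s * α p u + t * β p u = 0 := by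
    intro u
    rw [← g.inner_sharp α, ← g.inner_sharp β, ← smul_eq_mul, ← smul_eq_mul, ← map_smul,
      ← map_smul, ← map_add, hst, map_zero]
  obtain ⟨v, w, hvw⟩ := exists_covectorWedge_ne_zero h
  constructor
  · have : s * (α p v * β p w - α p w * β p v) = 0 := by
      linear_combination β p w * h1 v - β p v * h1 w
    exact (mul_eq_zero.1 this).resolve_right hvw
  · have : t * (α p v * β p w - α p w * β p v) = 0 := by
      linear_combination α p v * h1 w - α p w * h1 v
    exact (mul_eq_zero.1 this).resolve_right hvw

/-- A vector outside the span of `♯α`, `♯β` is not in the kernel of `⋆(α ∧ β)`. -/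
lemma LorentzMetric.exists_hodgeStar_ne_zero (g : LorentzMetric M) {ε : DiffForm 4 4 M}
    (hε : g.IsVolumeForm ε) {α β : OneForm 4 M} {p : M} (h : α.wedge β p ≠ 0)
    {v : TangentSpace (𝓡 4) p}
    (hv : v ∉ Submodule.span ℝ (Set.range ![g.sharp α p, g.sharp β p])) :
    ∃ w, g.hodgeStar ε (α.wedge β) p ![w, v] ≠ 0 := by
  -- `w` completes `v`, `♯α`, `♯β` to a basis. On a basis `ε` cannot vanish, because its square is
  -- the absolute value of a nonzero Gram determinant.
  obtain ⟨w, hw⟩ := exists_notMem_span (by norm_num) ![v, g.sharp α p, g.sharp β p]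
  have h3 : LinearIndependent ℝ ![v, g.sharp α p, g.sharp β p] :=
    linearIndependent_finCons.2 ⟨g.linearIndependent_sharp h, hv⟩
  have h4 : LinearIndependent ℝ ![w, v, g.sharp α p, g.sharp β p] :=
    linearIndependent_finCons.2 ⟨h3, hw⟩
  refine ⟨w, fun h0 => ?_⟩
  rw [g.hodgeStar_wedge_apply] at h0
  have h5 := hε.2 p ![w, v, g.sharp α p, g.sharp β p]
  rw [h0, zero_pow two_ne_zero] at h5
  exact g.det_ne_zero h4 (abs_eq_zero.1 h5.symm)

lemma LorentzMetric.hodgeStar_wedge_ne_zero (g : LorentzMetric M) {ε : DiffForm 4 4 M}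
    (hε : g.IsVolumeForm ε) {α β : OneForm 4 M} {p : M} (h : α.wedge β p ≠ 0) :
    g.hodgeStar ε (α.wedge β) p ≠ 0 := by
  obtain ⟨v, hv⟩ := exists_notMem_span (by norm_num) ![g.sharp α p, g.sharp β p]
  obtain ⟨w, hw⟩ := g.exists_hodgeStar_ne_zero hε h hv
  exact fun h0 => hw (by rw [h0]; rfl)

/-- The kernels of a simple 2-form and of its Hodge dual are orthogonal. -/
theorem LorentzMetric.inner_eq_zero_of_mem_kerInter (g : LorentzMetric M) {ε : DiffForm 4 4 M}
    (hε : g.IsVolumeForm ε) {α₀ α₁ β₀ β₁ : OneForm 4 M} {p : M} (h : α₀.wedge α₁ p ≠ 0)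
    (hd : g.hodgeStar ε (α₀.wedge α₁) = β₀.wedge β₁) {u v : TangentSpace (𝓡 4) p}
    (hu : u ∈ kerInter α₀ α₁ p) (hv : v ∈ kerInter β₀ β₁ p) : g.inner p u v = 0 := by
  rw [mem_kerInter] at hu hv
  -- A vector killed by `β₀` and `β₁` annihilates the dual form, so it must be a combination of
  -- `♯α₀` and `♯α₁`. Its product with `u` is then a combination of `α₀ u` and `α₁ u`.
  have hspan : v ∈ Submodule.span ℝ (Set.range ![g.sharp α₀ p, g.sharp α₁ p]) := by
    by_contra hv'
    obtain ⟨w, hw⟩ := g.exists_hodgeStar_ne_zero hε h hv'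
    rw [hd] at hw
    refine hw ?_
    change β₀ p w * β₁ p v - β₀ p v * β₁ p w = 0
    rw [hv.1, hv.2]; ring
  rw [Matrix.range_cons, Matrix.range_cons, Matrix.range_empty, Set.union_empty,
    Set.singleton_union, Submodule.mem_span_pair] at hspan
  obtain ⟨s, t, rfl⟩ := hspan
  rw [map_add, map_smul, map_smul, g.inner_sharp, g.inner_sharp, hu.1, hu.2]
  simp

end HodgeDual

end Spacetime

end

open Spacetime in
theorem mainTheorem1 {M : Type*} [TopologicalSpace M] [T2Space M] [SecondCountableTopology M]
    [ChartedSpace (EuclideanSpace ℝ (Fin 4)) M] [IsManifold (𝓡 4) ∞ M]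
    (g : LorentzMetric M) (ε : DiffForm 4 4 M) (hε : g.IsVolumeForm ε)
    (F : DiffForm 4 2 M) (hF : F.Smooth) (hF0 : ∀ p, F p ≠ 0)
    (hdF : F.Closed) (hdsF : (g.hodgeStar ε F).Closed)
    (α β : Fin 2 → OneForm 4 M) (hα : ∀ i, (α i).Smooth) (hβ : ∀ i, (β i).Smooth)
    (hFα : F = (α 0).wedge (α 1)) (hFβ : g.hodgeStar ε F = (β 0).wedge (β 1)) :
    (IsDistribution 2 (kerInter (α 0) (α 1)) ∧ IsInvolutive (kerInter (α 0) (α 1))) ∧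
    (IsDistribution 2 (kerInter (β 0) (β 1)) ∧ IsInvolutive (kerInter (β 0) (β 1))) ∧
    (∃! ℱ₁ : Set (Set M), IsFoliationOf 2 (kerInter (α 0) (α 1)) ℱ₁) ∧
    (∃! ℱ₂ : Set (Set M), IsFoliationOf 2 (kerInter (β 0) (β 1)) ℱ₂) ∧
    (∀ ℱ₁ ℱ₂ : Set (Set M), IsFoliationOf 2 (kerInter (α 0) (α 1)) ℱ₁ →
      IsFoliationOf 2 (kerInter (β 0) (β 1)) ℱ₂ → IsDualFoliation g ε α β ℱ₁ ℱ₂) ∧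
    (∀ (p : M), ∀ u ∈ kerInter (α 0) (α 1) p, ∀ v ∈ kerInter (β 0) (β 1) p,
      g.inner p u v = 0) := by
  subst hFα
  have hβ0 : ∀ p, (β 0).wedge (β 1) p ≠ 0 := fun p =>
    hFβ ▸ g.hodgeStar_wedge_ne_zero hε (hF0 p)
  have hdβ : ((β 0).wedge (β 1)).Closed := hFβ ▸ hdsF
  have hcα := exists_tangentChart_kerInter (hα 0) (hα 1) hF0 hdF
  have hcβ := exists_tangentChart_kerInter (hβ 0) (hβ 1) hβ0 hdβ
  exact ⟨⟨isDistribution_of_tangentCharts (by norm_num) hcα,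
      isInvolutive_kerInter (hα 0) (hα 1) hF0 hdF⟩,
    ⟨isDistribution_of_tangentCharts (by norm_num) hcβ,
      isInvolutive_kerInter (hβ 0) (hβ 1) hβ0 hdβ⟩,
    ⟨_, isFoliationOf_leaves hcα, fun _ h => h.unique (isFoliationOf_leaves hcα)⟩,
    ⟨_, isFoliationOf_leaves hcβ, fun _ h => h.unique (isFoliationOf_leaves hcβ)⟩,
    fun _ _ h₁ h₂ => ⟨hα, hβ, hF0, hβ0, hdF, hdβ, hFβ.symm, h₁, h₂⟩,
    fun p _ hu _ hv => g.inner_eq_zero_of_mem_kerInter hε (hF0 p) hFβ hu hv⟩
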